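/- Let $A$ be a (unital, associative, not necessarily commutative) ring and let $\mathcal C$ be an $A$-coring, i.e. an $A$-bimodule with $A$-bimodule maps $\Delta:\mathcal C\to\mathcal C\otimes_A\mathcal C$, $\Delta(c)=c_{(1)}\otimes_A c_{(2)}$ (summation understood), and $\varepsilon:\mathcal C\to A$ which are coassociative and counital. Let $x\in\mathcal C$ be a fixed grouplike element, i.e. $\Delta(x)=x\otimes_A x$ and $\varepsilon(x)=1$. Assume that $\mathcal C$ is a left $A$-progenerator (a finitely generated projective generator as a left $A$-module). Put $B=A^{\mathrm{co}\,\mathcal C}=\{b\in A\mid bx=xb\}$ and let $B'$ be a subring of $B$. Use the following notation. * $\mathrm{can}':A\otimes_{B'}A\to\mathcal C$ is the map $\mathrm{can}'(a\otimes_{B'}a')=axa'$. * ${}^*\mathcal C={}_A\mathrm{Hom}(\mathcal C,A)$ is the ring of left $A$-linear maps with multiplication $(f\#g)(c)=g(c_{(1)}f(c_{(2)}))$ and unit $\varepsilon$, and $i:A\to{}^*\mathcal C$ is the ring homomorphism $i(a)(c)=\varepsilon(c)a$. * ${}^*\mathrm{can}':{}^*\mathcal C\to{}_{B'}\mathrm{End}(A)^{\mathrm{op}}$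 is the ring homomorphism ${}^*\mathrm{can}'(f)(a)=f(xa)$; it corresponds to the left $A$-dual of $\mathrm{can}'$. * $Q=\{q\in{}^*\mathcal C\mid c_{(1)}q(c_{(2)})=q(c)x\text{ for all }c\in\mathcal C\}$, a $({}^*\mathcal C,B)$-bimodule, where ${}^*\mathcal C$ acts by left multiplication and $(q\cdot b)(c)=q(c)b$; $A$ is a $(B,{}^*\mathcal C)$-bimodule via $a\cdot f=f(xa)$; and $(B,{}^*\mathcal C,A,Q,\tau,\mu)$ is the Morita context with $\tau:A\otimes_{{}^*\mathcal C}Q\to B$, $\tau(a\otimes q)=q(xa)$, and $\mu:Q\otimes_BA\to{}^*\mathcal C$, $\mu(q\otimes a)=q\#i(a)$. It is called strict if $\tau$ and $\mu$ are isomorphisms. * $F:\mathcal M_B\to\mathcal M^{\mathcal C}$ and $G:\mathcal M^{\mathcal C}\to\mathcal M_B$ are the adjoint functors between right $B$-modules and right $\mathcal C$-comodules given by $F(N)=N\otimes_BA$, with coaction $n\otimes a\mapsto(n\otimes1)\otimes_A xa$, and $G(M)=M^{\mathrm{co}\,\mathcal C}=\{m\in M\mid\rho(m)=m\otimes_Ax\}$,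 with unit $n\mapsto n\otimes_B1$ and counit $m\otimes_Ba\mapsto ma$. Then the following statements are equivalent: 1. $\mathrm{can}'$ is an isomorphism, and $A$ is faithfully flat as a left $B'$-module; 2. ${}^*\mathrm{can}'$ is an isomorphism, and $A$ is a left $B'$-progenerator; 3. $B=B'$, and the Morita context $(B,{}^*\mathcal C,A,Q,\tau,\mu)$ is strict; 4. $B=B'$, and $(F,G)$ is an equivalence of categories. -/

import Mathlib

universe u

namespace GaloisCoring

open scoped TensorProduct
open MulOpposite (op unop)
open CategoryTheory (Category IsIso Functor)
open scoped CategoryTheory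

noncomputable section

/-! ### Tensor products over noncommutative rings

Right `R`-modules are modules over `Rᵐᵒᵖ`; thus `op r • m` is `m r`. -/

section Tensor

/-- The subgroup of `M ⊗_ℤ N` generated by the elements `m r ⊗ n - m ⊗ r n`. -/
def balancing (R M N : Type*) [Ring R] [AddCommGroup M] [Module Rᵐᵒᵖ M] [AddCommGroup N]
    [Module R N] : AddSubgroup (M ⊗[ℤ] N) :=
  AddSubgroup.closure
    {t | ∃ (m : M) (r : R) (n : N), t = (op r • m) ⊗ₜ[ℤ] n - m ⊗ₜ[ℤ] (r • n)}

/-- The tensor product `M ⊗_R N` of a right `R`-module `M` and a left `R`-module `N`. -/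
def NCTensor (R M N : Type*) [Ring R] [AddCommGroup M] [Module Rᵐᵒᵖ M] [AddCommGroup N]
    [Module R N] :=
  (M ⊗[ℤ] N) ⧸ balancing R M N

namespace NCTensor

variable {R S : Type*} [Ring R] [Ring S]
variable {M M' M'' N N' N'' P : Type*} [AddCommGroup M] [AddCommGroup M'] [AddCommGroup M'']
  [AddCommGroup N] [AddCommGroup N'] [AddCommGroup N''] [AddCommGroup P]
variable [Module Rᵐᵒᵖ M] [Module Rᵐᵒᵖ M'] [Module Rᵐᵒᵖ M''] [Module R N] [Module R N']
  [Module R N'']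

instance : AddCommGroup (NCTensor R M N) :=
  inferInstanceAs (AddCommGroup ((M ⊗[ℤ] N) ⧸ balancing R M N))

/-- The pure tensor `m ⊗_R n`. -/
def tmul (R : Type*) [Ring R] [Module Rᵐᵒᵖ M] [Module R N] (m : M) (n : N) : NCTensor R M N :=
  QuotientAddGroup.mk' (balancing R M N) (m ⊗ₜ[ℤ] n)

theorem add_tmul (m m' : M) (n : N) : tmul R (m + m') n = tmul R m n + tmul R m' n := by
  simp only [tmul, TensorProduct.add_tmul, map_add]; rfl

theorem tmul_add (m : M) (n n' : N) : tmul R m (n + n') = tmul R m n + tmul R m n' := by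
  simp only [tmul, TensorProduct.tmul_add, map_add]; rfl

theorem smul_tmul (m : M) (r : R) (n : N) : tmul R (op r • m) n = tmul R m (r • n) := by
  refine (QuotientAddGroup.eq_iff_sub_mem).2 (AddSubgroup.subset_closure ?_)
  exact ⟨m, r, n, rfl⟩

@[elab_as_elim]
theorem induction_on {p : NCTensor R M N → Prop} (t : NCTensor R M N)
    (tmul : ∀ m n, p (tmul R m n)) (add : ∀ s t, p s → p t → p (s + t)) : p t := by
  obtain ⟨t, rfl⟩ := QuotientAddGroup.mk'_surjective _ t
  induction t using TensorProduct.induction_on with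
  | zero => simpa [NCTensor.tmul] using tmul 0 0
  | tmul m n => exact tmul m n
  | add s t hs ht => rw [map_add]; exact add _ _ hs ht

/-- The universal property: a biadditive balanced map induces a map on `M ⊗_R N`. -/
def lift (f : M → N → P) (hl : ∀ m m' n, f (m + m') n = f m n + f m' n)
    (hr : ∀ m n n', f m (n + n') = f m n + f m n')
    (hb : ∀ m (r : R) n, f (op r • m) n = f m (r • n)) : NCTensor R M N →+ P :=
  let F : M →+ N →+ P := AddMonoidHom.mk' (fun m => AddMonoidHom.mk' (f m) (hr m))
    (fun m m' => AddMonoidHom.ext (hl m m'))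
  QuotientAddGroup.lift (balancing R M N)
    (TensorProduct.liftAddHom F (fun z m n => by simp))
    (by
      rw [balancing, AddSubgroup.closure_le]
      rintro _ ⟨m, r, n, rfl⟩
      simpa [F, sub_eq_zero] using hb m r n)

@[simp]
theorem lift_tmul (f : M → N → P) (hl hr hb) (m : M) (n : N) :
    lift (R := R) f hl hr hb (tmul R m n) = f m n := rfl

@[ext]
theorem hom_ext {f g : NCTensor R M N →+ P} (h : ∀ m n, f (tmul R m n) = g (tmul R m n)) :
    f = g := by
  ext t
  induction t using NCTensor.induction_on with
  | tmul m n => exact h m n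
  | add s t hs ht => rw [map_add, map_add, hs, ht]

/-- `f ⊗ g` for a right linear `f` and a left linear `g`. -/
def map (f : M →ₗ[Rᵐᵒᵖ] M') (g : N →ₗ[R] N') : NCTensor R M N →+ NCTensor R M' N' :=
  lift (fun m n => tmul R (f m) (g n)) (fun m m' n => by rw [map_add, add_tmul])
    (fun m n n' => by rw [map_add, tmul_add])
    (fun m r n => by rw [map_smul, map_smul, smul_tmul])

@[simp]
theorem map_tmul (f : M →ₗ[Rᵐᵒᵖ] M') (g : N →ₗ[R] N') (m : M) (n : N) :
    map f g (tmul R m n) = tmul R (f m) (g n) := rfl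

/-- The left `S`-module structure on `M ⊗_R N` for an `(S, R)`-bimodule `M`. -/
instance leftModule [Module S M] [SMulCommClass S Rᵐᵒᵖ M] : Module S (NCTensor R M N) where
  smul s := lift (fun m n => tmul R (s • m) n) (fun m m' n => by rw [smul_add, add_tmul])
    (fun m n n' => by rw [tmul_add]) (fun m r n => by rw [smul_comm, smul_tmul])
  one_smul t := by
    induction t using NCTensor.induction_on with
    | tmul m n => exact congrArg (tmul R · n) (one_smul S m)
    | add s t hs ht => exact (map_add (lift _ _ _ _) s t).trans (congrArg₂ (· + ·) hs ht)
  mul_smul a b t := by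
    induction t using NCTensor.induction_on with
    | tmul m n => exact congrArg (tmul R · n) (mul_smul a b m)
    | add s t hs ht =>
      refine (map_add (lift _ _ _ _) s t).trans ((congrArg₂ (· + ·) hs ht).trans ?_)
      refine (map_add (lift _ _ _ _) _ _).symm.trans (congrArg _ ?_)
      exact (map_add (lift _ _ _ _) s t).symm
  smul_zero a := map_zero (lift _ _ _ _)
  smul_add a s t := map_add (lift _ _ _ _) s t
  add_smul a b t := by
    induction t using NCTensor.induction_on with
    | tmul m n => exact (congrArg (tmul R · n) (add_smul a b m)).trans (add_tmul _ _ _)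
    | add s t hs ht =>
      refine (map_add (lift _ _ _ _) s t).trans ((congrArg₂ (· + ·) hs ht).trans ?_)
      refine (add_add_add_comm _ _ _ _).trans ?_
      exact congrArg₂ (· + ·) (map_add (lift _ _ _ _) s t).symm (map_add (lift _ _ _ _) s t).symm
  zero_smul t := by
    induction t using NCTensor.induction_on with
    | tmul m n =>
      refine (congrArg (tmul R · n) (zero_smul S m)).trans ?_
      simp only [tmul, TensorProduct.zero_tmul, map_zero]; rfl
    | add s t hs ht =>
      exact (map_add (lift _ _ _ _) s t).trans ((congrArg₂ (· + ·) hs ht).trans (add_zero 0))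

@[simp]
theorem left_smul_tmul [Module S M] [SMulCommClass S Rᵐᵒᵖ M] (s : S) (m : M) (n : N) :
    s • tmul R m n = tmul R (s • m) n := rfl

/-- The right `S`-module structure on `M ⊗_R N` for an `(R, S)`-bimodule `N`. -/
instance rightModule [Module Sᵐᵒᵖ N] [SMulCommClass R Sᵐᵒᵖ N] :
    Module Sᵐᵒᵖ (NCTensor R M N) where
  smul s := lift (fun m n => tmul R m (s • n)) (fun m m' n => by rw [add_tmul])
    (fun m n n' => by rw [smul_add, tmul_add]) (fun m r n => by rw [smul_tmul, smul_comm])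
  one_smul t := by
    induction t using NCTensor.induction_on with
    | tmul m n => exact congrArg (tmul R m) (one_smul Sᵐᵒᵖ n)
    | add s t hs ht => exact (map_add (lift _ _ _ _) s t).trans (congrArg₂ (· + ·) hs ht)
  mul_smul a b t := by
    induction t using NCTensor.induction_on with
    | tmul m n => exact congrArg (tmul R m) (mul_smul a b n)
    | add s t hs ht =>
      refine (map_add (lift _ _ _ _) s t).trans ((congrArg₂ (· + ·) hs ht).trans ?_)
      refine (map_add (lift _ _ _ _) _ _).symm.trans (congrArg _ ?_)
      exact (map_add (lift _ _ _ _) s t).symm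
  smul_zero a := map_zero (lift _ _ _ _)
  smul_add a s t := map_add (lift _ _ _ _) s t
  add_smul a b t := by
    induction t using NCTensor.induction_on with
    | tmul m n => exact (congrArg (tmul R m) (add_smul a b n)).trans (tmul_add _ _ _)
    | add s t hs ht =>
      refine (map_add (lift _ _ _ _) s t).trans ((congrArg₂ (· + ·) hs ht).trans ?_)
      refine (add_add_add_comm _ _ _ _).trans ?_
      exact congrArg₂ (· + ·) (map_add (lift _ _ _ _) s t).symm (map_add (lift _ _ _ _) s t).symm
  zero_smul t := by
    induction t using NCTensor.induction_on with
    | tmul m n =>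
      refine (congrArg (tmul R m) (zero_smul Sᵐᵒᵖ n)).trans ?_
      simp only [tmul, TensorProduct.tmul_zero, map_zero]; rfl
    | add s t hs ht =>
      exact (map_add (lift _ _ _ _) s t).trans ((congrArg₂ (· + ·) hs ht).trans (add_zero 0))

@[simp]
theorem right_smul_tmul [Module Sᵐᵒᵖ N] [SMulCommClass R Sᵐᵒᵖ N] (s : Sᵐᵒᵖ) (m : M) (n : N) :
    s • tmul R m n = tmul R m (s • n) := rfl

/-- The canonical isomorphism `M ⊗_R R ≅ M`, `m ⊗ r ↦ m r`, as a map. -/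
def rid (R M : Type*) [Ring R] [AddCommGroup M] [Module Rᵐᵒᵖ M] : NCTensor R M R →+ M :=
  lift (fun m r => op r • m) (fun m m' r => smul_add _ _ _)
    (fun m r r' => by rw [MulOpposite.op_add, add_smul])
    (fun m r s => by rw [smul_smul, ← MulOpposite.op_mul, smul_eq_mul])

@[simp]
theorem rid_tmul (m : M) (r : R) : rid R M (tmul R m r) = op r • m := rfl

/-- The canonical isomorphism `R ⊗_R N ≅ N`, `r ⊗ n ↦ r n`, as a map. -/
def lid (R N : Type*) [Ring R] [AddCommGroup N] [Module R N] : NCTensor R R N →+ N :=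
  lift (fun r n => r • n) (fun r r' n => add_smul _ _ _) (fun r n n' => smul_add _ _ _)
    (fun r s n => by rw [op_smul_eq_mul, mul_smul])

@[simp]
theorem lid_tmul (r : R) (n : N) : lid R N (tmul R r n) = r • n := rfl

/-- The associativity isomorphism `(M ⊗_R K) ⊗_S L ≅ M ⊗_R (K ⊗_S L)`. -/
def assoc (R S M K L : Type*) [Ring R] [Ring S] [AddCommGroup M] [Module Rᵐᵒᵖ M]
    [AddCommGroup K] [Module R K] [Module Sᵐᵒᵖ K] [SMulCommClass R Sᵐᵒᵖ K]
    [AddCommGroup L] [Module S L] :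
    NCTensor S (NCTensor R M K) L ≃+ NCTensor R M (NCTensor S K L) :=
  AddMonoidHom.toAddEquiv
    (lift
      (fun t l => lift (fun m k => tmul R m (tmul S k l)) (fun m m' k => by rw [add_tmul])
        (fun m k k' => by rw [add_tmul, tmul_add])
        (fun m r k => by rw [smul_tmul, left_smul_tmul]) t)
      (fun t t' l => map_add _ t t')
      (fun t l l' => by
        induction t using NCTensor.induction_on with
        | tmul m k => simp only [lift_tmul, tmul_add]
        | add s t hs ht => simp only [map_add, hs, ht]; abel)
      (fun t s l => by
        induction t using NCTensor.induction_on with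
        | tmul m k => simp only [right_smul_tmul, lift_tmul, smul_tmul]
        | add s t hs ht => simp only [smul_add, map_add, hs, ht]))
    (lift
      (fun m t => lift (fun k l => tmul S (tmul R m k) l)
        (fun k k' l => by rw [tmul_add, add_tmul]) (fun k l l' => by rw [tmul_add])
        (fun k s l => by rw [← smul_tmul, right_smul_tmul]) t)
      (fun m m' t => by
        induction t using NCTensor.induction_on with
        | tmul k l => simp only [lift_tmul, add_tmul]
        | add s t hs ht => simp only [map_add, hs, ht]; abel)
      (fun m t t' => map_add _ t t')
      (fun m r t => by
        induction t using NCTensor.induction_on with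
        | tmul k l => simp only [left_smul_tmul, lift_tmul, smul_tmul]
        | add s t hs ht => simp only [smul_add, map_add, hs, ht]))
    (by
      ext t l
      induction t using NCTensor.induction_on with
      | tmul m k => rfl
      | add s t hs ht => simp only [add_tmul, map_add, hs, ht])
    (by
      ext m t
      induction t using NCTensor.induction_on with
      | tmul k l => rfl
      | add s t hs ht => simp only [tmul_add, map_add, hs, ht])

@[simp]
theorem assoc_tmul {K L : Type*} [AddCommGroup K] [Module R K] [Module Sᵐᵒᵖ K]
    [SMulCommClass R Sᵐᵒᵖ K] [AddCommGroup L] [Module S L] (m : M) (k : K) (l : L) :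
    assoc R S M K L (tmul S (tmul R m k) l) = tmul R m (tmul S k l) := rfl

end NCTensor

end Tensor

open NCTensor

/-! ### Progenerators and faithful flatness for left modules -/

/-- A left `R`-progenerator: a finitely generated projective generator, where `N` is a generator
when `R` is a quotient of some finite power of `N`. -/
structure IsProgenerator (R N : Type*) [Ring R] [AddCommGroup N] [Module R N] : Prop where
  finite : Module.Finite R N
  projective : Module.Projective R N
  generator : ∃ (n : ℕ) (g : (Fin n → N) →ₗ[R] R), Function.Surjective g

/-- The left `R`-module `N` is faithfully flat: a sequence of right `R`-modules is exact if and
only if it is exact after applying `- ⊗_R N`. -/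
def IsFaithfullyFlat (R N : Type u) [Ring R] [AddCommGroup N] [Module R N] : Prop :=
  ∀ (M₁ M₂ M₃ : Type u) [AddCommGroup M₁] [AddCommGroup M₂] [AddCommGroup M₃]
    [Module Rᵐᵒᵖ M₁] [Module Rᵐᵒᵖ M₂] [Module Rᵐᵒᵖ M₃]
    (f : M₁ →ₗ[Rᵐᵒᵖ] M₂) (g : M₂ →ₗ[Rᵐᵒᵖ] M₃),
    Function.Exact f g ↔
      Function.Exact (NCTensor.map f (LinearMap.id : N →ₗ[R] N))
        (NCTensor.map g (LinearMap.id : N →ₗ[R] N))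

/-- Restriction of a right action to a subring. -/
instance subringRightModule {A M : Type*} [Ring A] [AddCommGroup M] [Module Aᵐᵒᵖ M]
    (S : Subring A) : Module (↥S)ᵐᵒᵖ M :=
  Module.compHom M S.subtype.op

theorem subring_op_smul {A M : Type*} [Ring A] [AddCommGroup M] [Module Aᵐᵒᵖ M]
    {S : Subring A} (s : S) (m : M) : op s • m = op (s : A) • m := rfl

instance {A M : Type*} [Ring A] [AddCommGroup M] [Module A M] [Module Aᵐᵒᵖ M]
    [SMulCommClass A Aᵐᵒᵖ M] (S : Subring A) : SMulCommClass A (↥S)ᵐᵒᵖ M :=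
  ⟨fun a s m => smul_comm a (op ((unop s).1 : A)) m⟩

/-! ### Morita contexts -/

/-- A Morita context `(R, S, P, Q, τ, μ)`: an `(R, S)`-bimodule `P`, an `(S, R)`-bimodule `Q`, and
bimodule maps `τ : P ⊗_S Q → R` and `μ : Q ⊗_R P → S` such that `τ(p ⊗ q) p' = p μ(q ⊗ p')` and
`μ(q ⊗ p) q' = q τ(p ⊗ q')`. -/
structure MoritaContext (R S P Q : Type*) [Ring R] [Ring S] [AddCommGroup P] [Module R P]
    [Module Sᵐᵒᵖ P] [SMulCommClass R Sᵐᵒᵖ P] [AddCommGroup Q] [Module S Q] [Module Rᵐᵒᵖ Q]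
    [SMulCommClass S Rᵐᵒᵖ Q] where
  τ : NCTensor S P Q →+ R
  τ_smul : ∀ (r : R) t, τ (r • t) = r * τ t
  τ_op_smul : ∀ (r : R) t, τ (op r • t) = τ t * r
  μ : NCTensor R Q P →+ S
  μ_smul : ∀ (s : S) t, μ (s • t) = s * μ t
  μ_op_smul : ∀ (s : S) t, μ (op s • t) = μ t * s
  τ_smul_eq : ∀ p q p', τ (tmul S p q) • p' = op (μ (tmul R q p')) • p
  μ_smul_eq : ∀ q p q', μ (tmul R q p) • q' = op (τ (tmul S p q')) • q

/-- A Morita context is strict if both its maps are isomorphisms. -/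
def MoritaContext.IsStrict {R S P Q : Type*} [Ring R] [Ring S] [AddCommGroup P] [Module R P]
    [Module Sᵐᵒᵖ P] [SMulCommClass R Sᵐᵒᵖ P] [AddCommGroup Q] [Module S Q] [Module Rᵐᵒᵖ Q]
    [SMulCommClass S Rᵐᵒᵖ Q] (m : MoritaContext R S P Q) : Prop :=
  Function.Bijective m.τ ∧ Function.Bijective m.μ

/-! ### Corings -/

/-- A map of `A`-bimodules. -/
structure BimodHom (A M N : Type*) [Ring A] [AddCommGroup M] [Module A M] [Module Aᵐᵒᵖ M]
    [AddCommGroup N] [Module A N] [Module Aᵐᵒᵖ N] extends M →ₗ[A] N where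
  map_op_smul' : ∀ (a : A) (m : M), toFun (op a • m) = op a • toFun m

namespace BimodHom

variable {A M N : Type*} [Ring A] [AddCommGroup M] [Module A M] [Module Aᵐᵒᵖ M]
    [AddCommGroup N] [Module A N] [Module Aᵐᵒᵖ N]

/-- The underlying left linear map. -/
abbrev left (f : BimodHom A M N) : M →ₗ[A] N := f.toLinearMap

/-- The underlying right linear map. -/
def right (f : BimodHom A M N) : M →ₗ[Aᵐᵒᵖ] N where
  toFun := f.left
  map_add' := f.left.map_add
  map_smul' a m := f.map_op_smul' (unop a) m

@[simp]
theorem right_apply (f : BimodHom A M N) (m : M) : f.right m = f.left m := rfl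

end BimodHom

/-- An `A`-coring structure on the `A`-bimodule `C`. -/
structure Coring (A C : Type u) [Ring A] [AddCommGroup C] [Module A C] [Module Aᵐᵒᵖ C]
    [SMulCommClass A Aᵐᵒᵖ C] where
  /-- The comultiplication. -/
  comul : BimodHom A C (NCTensor A C C)
  /-- The counit. -/
  counit : BimodHom A C A
  coassoc : ∀ c, assoc A A C C C (map comul.right LinearMap.id (comul.left c)) =
    map LinearMap.id comul.left (comul.left c)
  map_id_counit : ∀ c, rid A C (map LinearMap.id counit.left (comul.left c)) = c
  map_counit_id : ∀ c, lid A C (map counit.right LinearMap.id (comul.left c)) = c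

/-- `m ⊗ c ↦ m f(c)`. -/
def contract {A M C : Type*} [Ring A] [AddCommGroup M] [Module Aᵐᵒᵖ M] [AddCommGroup C]
    [Module A C] (f : C →ₗ[A] A) : NCTensor A M C →+ M :=
  (rid A M).comp (map LinearMap.id f)

@[simp]
theorem contract_tmul {A M C : Type*} [Ring A] [AddCommGroup M] [Module Aᵐᵒᵖ M] [AddCommGroup C]
    [Module A C] (f : C →ₗ[A] A) (m : M) (c : C) :
    contract f (tmul A m c) = op (f c) • m := rfl

namespace Coring

variable {A C : Type u} [Ring A] [AddCommGroup C] [Module A C] [Module Aᵐᵒᵖ C]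
  [SMulCommClass A Aᵐᵒᵖ C]

/-- `c₁ f(c₂)` as a left linear function of `c`. -/
def coact (𝒞 : Coring A C) (f : C →ₗ[A] A) : C →ₗ[A] C where
  toFun c := contract f (𝒞.comul.left c)
  map_add' c d := by rw [map_add, map_add]
  map_smul' a c := by
    rw [map_smul, RingHom.id_apply]
    induction 𝒞.comul.left c using NCTensor.induction_on with
    | tmul c d => simp only [left_smul_tmul, contract_tmul, smul_comm a]
    | add s t hs ht => rw [smul_add, map_add, hs, ht, map_add, smul_add]

theorem coact_apply (𝒞 : Coring A C) (f : C →ₗ[A] A) (c : C) :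
    𝒞.coact f c = contract f (𝒞.comul.left c) := rfl

/-- The left dual `*C = Hom_A(C, A)` of left `A`-linear maps, with the ring structure
`(f # g)(c) = g(c₁ f(c₂))` and unit `ε`. -/
def LeftDual (_ : Coring A C) : Type u := C →ₗ[A] A

namespace LeftDual

variable {𝒞 : Coring A C}

instance : AddCommGroup 𝒞.LeftDual := inferInstanceAs (AddCommGroup (C →ₗ[A] A))

/-- An element of the left dual as a linear map. -/
def toLin (f : 𝒞.LeftDual) : C →ₗ[A] A := f

/-- A linear map as an element of the left dual. -/
def ofLin (f : C →ₗ[A] A) : 𝒞.LeftDual := f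

@[simp] theorem toLin_ofLin (f : C →ₗ[A] A) : (ofLin f : 𝒞.LeftDual).toLin = f := rfl

@[ext] theorem ext {f g : 𝒞.LeftDual} (h : ∀ c, f.toLin c = g.toLin c) : f = g :=
  LinearMap.ext h

@[simp] theorem add_toLin (f g : 𝒞.LeftDual) (c : C) :
    (f + g).toLin c = f.toLin c + g.toLin c := rfl

@[simp] theorem zero_toLin (c : C) : (0 : 𝒞.LeftDual).toLin c = 0 := rfl

instance : Mul 𝒞.LeftDual := ⟨fun f g => ofLin (g.toLin ∘ₗ 𝒞.coact f.toLin)⟩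

instance : One 𝒞.LeftDual := ⟨ofLin 𝒞.counit.left⟩

theorem mul_toLin (f g : 𝒞.LeftDual) (c : C) :
    (f * g).toLin c = g.toLin (contract f.toLin (𝒞.comul.left c)) := rfl

theorem one_toLin (c : C) : (1 : 𝒞.LeftDual).toLin c = 𝒞.counit.left c := rfl

theorem comul_op_smul (a : A) (c : C) :
    𝒞.comul.left (op a • c) = op a • 𝒞.comul.left c := 𝒞.comul.map_op_smul' a c

theorem counit_op_smul (a : A) (c : C) :
    𝒞.counit.left (op a • c) = 𝒞.counit.left c * a := 𝒞.counit.map_op_smul' a c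

theorem mul_assoc_aux (f g : C →ₗ[A] A) (c : C) :
    𝒞.coact g (𝒞.coact f c) = contract (g ∘ₗ 𝒞.coact f) (𝒞.comul.left c) := by
  have h1 : 𝒞.coact g (𝒞.coact f c) =
      contract g (contract f (map 𝒞.comul.right LinearMap.id (𝒞.comul.left c))) := by
    rw [coact_apply, coact_apply]
    congr 1
    induction 𝒞.comul.left c using NCTensor.induction_on with
    | tmul m n => simp only [contract_tmul, comul_op_smul, map_tmul, BimodHom.right_apply,
        LinearMap.id_apply]
    | add s t hs ht => simp only [map_add, hs, ht]
  let Ψ : NCTensor A C (NCTensor A C C) →+ C :=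
    NCTensor.lift (fun c t => op (g (contract f t)) • c) (fun m m' n => smul_add _ _ _)
      (fun m n n' => by rw [map_add, map_add, MulOpposite.op_add, add_smul])
      (fun m r n => by
        rw [smul_smul, ← MulOpposite.op_mul]
        congr 2
        rw [← smul_eq_mul, ← map_smul]
        congr 1
        induction n using NCTensor.induction_on with
        | tmul c d => simp only [left_smul_tmul, contract_tmul, smul_comm r]
        | add s t hs ht => rw [smul_add, map_add, map_add, smul_add, hs, ht])
  have h2 : ∀ t, contract g (contract f t) = Ψ (assoc A A C C C t) := by
    intro t
    induction t using NCTensor.induction_on with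
    | tmul t e =>
      induction t using NCTensor.induction_on with
      | tmul c d => rfl
      | add s t hs ht =>
        simp only [add_tmul, map_add, hs, ht]
    | add s t hs ht => simp only [map_add, hs, ht]
  rw [h1, h2, 𝒞.coassoc]
  induction 𝒞.comul.left c using NCTensor.induction_on with
  | tmul m n => rfl
  | add s t hs ht => simp only [map_add, hs, ht]

instance : Ring 𝒞.LeftDual :=
  { (inferInstance : AddCommGroup 𝒞.LeftDual) with
    mul := (· * ·)
    one := 1
    left_distrib := fun f g h => by ext c; rfl
    right_distrib := fun f g h => by
      ext c
      rw [add_toLin, mul_toLin, mul_toLin, mul_toLin, ← map_add]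
      congr 1
      induction 𝒞.comul.left c using NCTensor.induction_on with
      | tmul m n =>
        rw [contract_tmul, contract_tmul, contract_tmul, add_toLin, MulOpposite.op_add, add_smul]
      | add s t hs ht => rw [map_add, map_add, map_add, hs, ht]; abel
    zero_mul := fun f => by
      ext c
      rw [mul_toLin, zero_toLin, ← map_zero f.toLin]
      congr 1
      induction 𝒞.comul.left c using NCTensor.induction_on with
      | tmul m n => rw [contract_tmul, zero_toLin, MulOpposite.op_zero, zero_smul]
      | add s t hs ht => rw [map_add, hs, ht, add_zero]
    mul_zero := fun f => by ext c; rfl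
    mul_assoc := fun f g h => by
      ext c
      rw [mul_toLin, mul_toLin, mul_toLin]
      exact congrArg h.toLin (mul_assoc_aux f.toLin g.toLin c).symm
    one_mul := fun f => by
      ext c
      exact congrArg f.toLin (𝒞.map_id_counit c)
    mul_one := fun f => by
      ext c
      rw [mul_toLin, one_toLin]
      conv_rhs => rw [← 𝒞.map_counit_id c]
      induction 𝒞.comul.left c using NCTensor.induction_on with
      | tmul m n =>
        rw [contract_tmul, counit_op_smul, map_tmul, lid_tmul, map_smul]; rfl
      | add s t hs ht => simp only [map_add, hs, ht] }

/-- The right `A`-action `(f a)(c) = f(c) a` on the left dual. -/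
instance : Module Aᵐᵒᵖ 𝒞.LeftDual := inferInstanceAs (Module Aᵐᵒᵖ (C →ₗ[A] A))

@[simp] theorem op_smul_toLin (a : A) (f : 𝒞.LeftDual) (c : C) :
    (op a • f).toLin c = f.toLin c * a := rfl

end LeftDual

open LeftDual

/-- A grouplike element: `Δ(x) = x ⊗ x` and `ε(x) = 1`. -/
structure Grouplike (𝒞 : Coring A C) where
  val : C
  comul_val : 𝒞.comul.left val = tmul A val val
  counit_val : 𝒞.counit.left val = 1

namespace Grouplike

variable {𝒞 : Coring A C} (x : 𝒞.Grouplike)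

/-- The subring `B = A^{co C} = {b | b x = x b}`. -/
def coinv : Subring A where
  carrier := {b | b • x.val = op b • x.val}
  mul_mem' {a b} ha hb := by
    simp only [Set.mem_ofPred_eq] at *
    rw [mul_smul, hb, smul_comm, ha, smul_smul, MulOpposite.op_mul]
  one_mem' := by simp
  add_mem' {a b} ha hb := by
    simp only [Set.mem_ofPred_eq] at *
    rw [add_smul, MulOpposite.op_add, add_smul, ha, hb]
  zero_mem' := by simp
  neg_mem' {a} ha := by
    simp only [Set.mem_ofPred_eq] at *
    rw [neg_smul, MulOpposite.op_neg, neg_smul, ha]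

variable {x} in
theorem smul_val {b : A} (hb : b ∈ x.coinv) : b • x.val = op b • x.val := hb

/-- With the coaction `a ↦ 1 ⊗ x a` on `A`, the coinvariants of `A` are `{b | b x = x b}`. -/
theorem mem_coinv_iff (b : A) :
    b ∈ x.coinv ↔ tmul A (1 : A) (op b • x.val) = tmul A b x.val := by
  constructor
  · intro h
    rw [← smul_val h, ← smul_tmul, op_smul_eq_mul, one_mul]
  · intro h
    have := congrArg (lid A C) h
    rw [lid_tmul, lid_tmul, one_smul] at this
    exact this.symm

theorem comul_op_smul_val (a : A) :
    𝒞.comul.left (op a • x.val) = tmul A x.val (op a • x.val) := by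
  rw [comul_op_smul, x.comul_val, right_smul_tmul]

/-! ### The canonical maps -/

/-- `can' : A ⊗_{B'} A → C`, `a ⊗ a' ↦ a x a'`, for a subring `B'` of `B`. -/
def can (B' : Subring A) (hB' : B' ≤ x.coinv) : BimodHom A (NCTensor B' A A) C where
  toFun := NCTensor.lift (fun a a' => a • op a' • x.val) (fun _ _ _ => add_smul _ _ _)
    (fun _ _ _ => by rw [MulOpposite.op_add, add_smul, smul_add])
    (fun a b a' => by
      rw [subring_op_smul, op_smul_eq_mul, mul_smul, Subring.smul_def, smul_eq_mul, MulOpposite.op_mul,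
        mul_smul, ← smul_val (hB' b.2), ← smul_comm (b : A) (op a')])
  map_add' := map_add _
  map_smul' a t := by
    induction t using NCTensor.induction_on with
    | tmul m n => exact mul_smul a m (op n • x.val)
    | add s t hs ht => simp only [smul_add, map_add] at *; rw [hs, ht]
  map_op_smul' a t := by
    induction t using NCTensor.induction_on with
    | tmul m n =>
      rw [right_smul_tmul, op_smul_eq_mul]
      simp only [lift_tmul]
      rw [MulOpposite.op_mul, mul_smul, smul_comm m (op a)]
    | add s t hs ht => simp only [smul_add, map_add] at *; rw [hs, ht]

theorem can_tmul (B' : Subring A) (hB' : B' ≤ x.coinv) (a a' : A) :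
    (x.can B' hB').left (tmul B' a a') = a • op a' • x.val := rfl

/-- `*can' : *C → End_{B'}(A)^op`, `f ↦ (a ↦ f(x a))`. -/
def dualCan (B' : Subring A) (hB' : B' ≤ x.coinv) :
    𝒞.LeftDual →+* (Module.End B' A)ᵐᵒᵖ where
  toFun f := op
    { toFun := fun a => f.toLin (op a • x.val)
      map_add' := fun a a' => by rw [MulOpposite.op_add, add_smul, map_add]
      map_smul' := fun b a => by
        rw [Subring.smul_def, smul_eq_mul, MulOpposite.op_mul, mul_smul, ← smul_val (hB' b.2),
          ← smul_comm (b : A) (op a), map_smul]; rfl }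
  map_one' := by
    rw [← MulOpposite.op_one, MulOpposite.op_inj]
    ext a
    change 𝒞.counit.left (op a • x.val) = a
    rw [counit_op_smul, x.counit_val, one_mul]
  map_mul' f g := by
    rw [← MulOpposite.op_mul, MulOpposite.op_inj]
    ext a
    change (f * g).toLin (op a • x.val) = g.toLin (op (f.toLin (op a • x.val)) • x.val)
    rw [mul_toLin, comul_op_smul_val, contract_tmul]
  map_zero' := rfl
  map_add' f g := rfl

theorem dualCan_apply (B' : Subring A) (hB' : B' ≤ x.coinv) (f : 𝒞.LeftDual) (a : A) :
    (x.dualCan B' hB' f).unop a = f.toLin (op a • x.val) := rfl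

/-- `*can'(f)` corresponds to `f ∘ can'` under `Hom_A(A ⊗_{B'} A, A) ≅ End_{B'}(A)`. -/
theorem dualCan_eq_comp (B' : Subring A) (hB' : B' ≤ x.coinv) (f : 𝒞.LeftDual) (a : A) :
    (x.dualCan B' hB' f).unop a = f.toLin ((x.can B' hB').left (tmul B' 1 a)) := by
  rw [can_tmul, one_smul, dualCan_apply]

/-! ### The Morita context -/

/-- The ring `A` regarded as a `(B, *C)`-bimodule, with `a · f = f(x a)`. -/
def Base (_ : 𝒞.Grouplike) : Type u := A

instance : AddCommGroup x.Base := inferInstanceAs (AddCommGroup A)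

instance : Module x.coinv x.Base := inferInstanceAs (Module x.coinv A)

/-- An element of `A` as an element of the bimodule. -/
def toBase (a : A) : x.Base := a

variable {x} in
/-- An element of the bimodule as an element of `A`. -/
def ofBase (a : x.Base) : A := a

instance : Module (𝒞.LeftDual)ᵐᵒᵖ x.Base where
  smul f a := x.toBase ((unop f).toLin (op (ofBase a) • x.val))
  one_smul a := by
    change 𝒞.counit.left (op (ofBase a) • x.val) = ofBase a
    rw [counit_op_smul, x.counit_val, one_mul]
  mul_smul f g a := by
    change (unop g * unop f).toLin (op (ofBase a) • x.val) =
      (unop f).toLin (op ((unop g).toLin (op (ofBase a) • x.val)) • x.val)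
    rw [mul_toLin, comul_op_smul_val, contract_tmul]
  smul_zero f := by
    change (unop f).toLin (op (0 : A) • x.val) = 0
    rw [MulOpposite.op_zero, zero_smul, map_zero]
  smul_add f a b := by
    change (unop f).toLin (op (ofBase a + ofBase b) • x.val) =
      (unop f).toLin (op (ofBase a) • x.val) + (unop f).toLin (op (ofBase b) • x.val)
    rw [MulOpposite.op_add, add_smul, map_add]
  add_smul f g a := rfl
  zero_smul a := rfl

theorem op_smul_base (f : 𝒞.LeftDual) (a : x.Base) :
    op f • a = x.toBase (f.toLin (op (ofBase a) • x.val)) := rfl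

instance : SMulCommClass x.coinv (𝒞.LeftDual)ᵐᵒᵖ x.Base where
  smul_comm b f a := by
    change (b : A) * (unop f).toLin (op (ofBase a) • x.val) =
      (unop f).toLin (op ((b : A) * ofBase a) • x.val)
    rw [MulOpposite.op_mul, mul_smul, ← smul_val b.2, ← smul_comm (b : A) (op (ofBase a)) x.val,
      map_smul (unop f).toLin (b : A), smul_eq_mul]

/-- `Q = {q ∈ *C | c₁ q(c₂) = q(c) x for all c}`, as a right `B`-submodule of `*C`. -/
def Q : Submodule (x.coinv)ᵐᵒᵖ 𝒞.LeftDual where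
  carrier := {q | ∀ c, contract q.toLin (𝒞.comul.left c) = q.toLin c • x.val}
  add_mem' {p q} hp hq c := by
    rw [add_toLin, add_smul, ← hp, ← hq]
    induction 𝒞.comul.left c using NCTensor.induction_on with
    | tmul m n => simp only [contract_tmul, add_toLin, MulOpposite.op_add, add_smul]
    | add s t hs ht => simp only [map_add, hs, ht]; abel
  zero_mem' c := by
    rw [zero_toLin, zero_smul]
    induction 𝒞.comul.left c using NCTensor.induction_on with
    | tmul m n => simp only [contract_tmul, zero_toLin, MulOpposite.op_zero, zero_smul]
    | add s t hs ht => rw [map_add, hs, ht, add_zero]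
  smul_mem' b q hq c := by
    have h : ∀ t : NCTensor A C C, contract (b • q).toLin t =
        op ((unop b).1 : A) • contract q.toLin t := by
      intro t
      induction t using NCTensor.induction_on with
      | tmul m n =>
        rw [contract_tmul, contract_tmul, smul_smul, ← MulOpposite.op_mul]; rfl
      | add s t hs ht => simp only [map_add, hs, ht, smul_add]
    rw [h, hq, ← smul_comm (q.toLin c), ← smul_val (unop b).2, smul_smul]; rfl

theorem mul_mem_Q (f : 𝒞.LeftDual) {q : 𝒞.LeftDual} (hq : q ∈ x.Q) : f * q ∈ x.Q := by
  intro c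
  rw [mul_toLin, ← hq]
  exact (mul_assoc_aux f.toLin q.toLin c).symm

/-- The left `*C`-action on `Q` by multiplication. -/
instance : Module 𝒞.LeftDual x.Q where
  smul f q := ⟨f * q, x.mul_mem_Q f q.2⟩
  one_smul _ := Subtype.ext (one_mul _)
  mul_smul _ _ _ := Subtype.ext (mul_assoc _ _ _)
  smul_zero _ := Subtype.ext (mul_zero _)
  smul_add _ _ _ := Subtype.ext (mul_add _ _ _)
  add_smul _ _ _ := Subtype.ext (add_mul _ _ _)
  zero_smul _ := Subtype.ext (zero_mul _)

theorem coe_smul_Q (f : 𝒞.LeftDual) (q : x.Q) : ((f • q : x.Q) : 𝒞.LeftDual) = f * q := rfl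

instance : SMulCommClass 𝒞.LeftDual (x.coinv)ᵐᵒᵖ x.Q where
  smul_comm f b q := by
    apply Subtype.ext
    ext c
    rfl

/-- `i : A → *C`, `i(a)(c) = ε(c) a`. -/
def _root_.GaloisCoring.Coring.toLeftDual (𝒞 : Coring A C) (a : A) : 𝒞.LeftDual :=
  op a • (1 : 𝒞.LeftDual)

theorem mul_toLeftDual (f : 𝒞.LeftDual) (a : A) : f * 𝒞.toLeftDual a = op a • f := by
  ext c
  have := congrArg (fun g => g.toLin c * a) (mul_one f)
  exact this

theorem mul_toLeftDual_apply (f : 𝒞.LeftDual) (a : A) (c : C) :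
    (f * 𝒞.toLeftDual a).toLin c = f.toLin c * a := by
  rw [mul_toLeftDual, op_smul_toLin]

theorem toLeftDual_add (a b : A) : 𝒞.toLeftDual (a + b) = 𝒞.toLeftDual a + 𝒞.toLeftDual b := by
  ext c
  exact mul_add _ a b

theorem mul_toLeftDual_mul (q : x.Q) (a : A) (f : 𝒞.LeftDual) :
    q.1 * 𝒞.toLeftDual a * f = q.1 * 𝒞.toLeftDual (f.toLin (op a • x.val)) := by
  ext c
  rw [mul_toLeftDual_apply, mul_toLin, mul_toLeftDual]
  have h : contract (op a • q.1).toLin (𝒞.comul.left c) =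
      op a • contract q.1.toLin (𝒞.comul.left c) := by
    induction 𝒞.comul.left c using NCTensor.induction_on with
    | tmul m n => rw [contract_tmul, contract_tmul, smul_smul, ← MulOpposite.op_mul]; rfl
    | add s t hs ht => simp only [map_add, hs, ht, smul_add]
  rw [h, q.2 c, ← smul_comm (q.1.toLin c) (op a) x.val, map_smul, smul_eq_mul]

/-- `τ : A ⊗_{*C} Q → B`, `τ(a ⊗ q) = q(x a)`. -/
def moritaτ : NCTensor 𝒞.LeftDual x.Base x.Q →+ x.coinv :=
  NCTensor.lift
    (fun a q => ⟨q.1.toLin (op (ofBase a) • x.val), by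
      have h := q.2 (op (ofBase a) • x.val)
      rw [comul_op_smul_val, contract_tmul] at h
      exact h.symm⟩)
    (fun a a' q => Subtype.ext (by
      have h : op (ofBase a + ofBase a') • x.val =
          op (ofBase a) • x.val + op (ofBase a') • x.val := by
        rw [MulOpposite.op_add, add_smul]
      exact (congrArg q.1.toLin h).trans (map_add q.1.toLin _ _)))
    (fun a q q' => rfl)
    (fun a f q => Subtype.ext (by
      change q.1.toLin (op (f.toLin (op (ofBase a) • x.val)) • x.val) =
        (f * q.1).toLin (op (ofBase a) • x.val)
      rw [mul_toLin, comul_op_smul_val, contract_tmul]))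

theorem moritaτ_tmul (a : x.Base) (q : x.Q) :
    (x.moritaτ (tmul 𝒞.LeftDual a q) : A) = q.1.toLin (op (ofBase a) • x.val) := rfl

/-- `μ : Q ⊗_B A → *C`, `μ(q ⊗ a) = q # i(a)`. -/
def moritaμ : NCTensor x.coinv x.Q x.Base →+ 𝒞.LeftDual :=
  NCTensor.lift (fun q a => q.1 * 𝒞.toLeftDual (ofBase a))
    (fun q q' a => add_mul _ _ _)
    (fun q a a' => by
      rw [← mul_add, ← toLeftDual_add]; rfl)
    (fun q b a => by
      ext c
      rw [mul_toLeftDual_apply, mul_toLeftDual_apply]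
      exact mul_assoc (q.1.toLin c) (b : A) (ofBase a))

theorem moritaμ_tmul (q : x.Q) (a : x.Base) :
    x.moritaμ (tmul x.coinv q a) = q.1 * 𝒞.toLeftDual (ofBase a) := rfl

/-- The Morita context `(B, *C, A, Q, τ, μ)`. -/
def moritaContext : MoritaContext x.coinv 𝒞.LeftDual x.Base x.Q where
  τ := x.moritaτ
  τ_smul b t := by
    induction t using NCTensor.induction_on with
    | tmul a q =>
      apply Subtype.ext
      change q.1.toLin (op ((b : A) * ofBase a) • x.val) =
        (b : A) * q.1.toLin (op (ofBase a) • x.val)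
      rw [MulOpposite.op_mul, mul_smul, ← smul_val b.2,
        ← smul_comm (b : A) (op (ofBase a)) x.val,
        map_smul q.1.toLin (b : A), smul_eq_mul]
    | add s t hs ht => rw [smul_add, map_add, map_add, mul_add, hs, ht]
  τ_op_smul b t := by
    induction t using NCTensor.induction_on with
    | tmul a q => rfl
    | add s t hs ht => rw [smul_add, map_add, map_add, add_mul, hs, ht]
  μ := x.moritaμ
  μ_smul f t := by
    induction t using NCTensor.induction_on with
    | tmul q a => exact mul_assoc f q.1 (𝒞.toLeftDual (ofBase a))
    | add s t hs ht => rw [smul_add, map_add, map_add, mul_add, hs, ht]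
  μ_op_smul f t := by
    induction t using NCTensor.induction_on with
    | tmul q a => exact (x.mul_toLeftDual_mul q (ofBase a) f).symm
    | add s t hs ht => rw [smul_add, map_add, map_add, add_mul, hs, ht]
  τ_smul_eq a q a' := (mul_toLeftDual_apply q.1 (ofBase a') (op (ofBase a) • x.val)).symm
  μ_smul_eq q a q' := Subtype.ext
    ((x.mul_toLeftDual_mul q (ofBase a) q'.1).trans (mul_toLeftDual q.1 _))

end Grouplike

/-! ### Comodules and the adjoint pair `(F, G)` -/

/-- A right `C`-comodule. -/
structure RightComodule (𝒞 : Coring A C) where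
  carrier : Type u
  [addCommGroup : AddCommGroup carrier]
  [module : Module Aᵐᵒᵖ carrier]
  /-- The coaction. -/
  coaction : carrier →ₗ[Aᵐᵒᵖ] NCTensor A carrier C
  coassoc : ∀ m, assoc A A carrier C C (map coaction LinearMap.id (coaction m)) =
    map LinearMap.id 𝒞.comul.left (coaction m)
  map_id_counit : ∀ m, rid A carrier (map LinearMap.id 𝒞.counit.left (coaction m)) = m

attribute [instance] RightComodule.addCommGroup RightComodule.module

namespace RightComodule

variable {𝒞 : Coring A C}

/-- A right `C`-colinear map. -/
@[ext]
structure Hom (M N : RightComodule 𝒞) where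
  toLin : M.carrier →ₗ[Aᵐᵒᵖ] N.carrier
  colinear : ∀ m, N.coaction (toLin m) = map toLin LinearMap.id (M.coaction m)

/-- The category of right `C`-comodules. -/
instance : Category (RightComodule 𝒞) where
  Hom := Hom
  id M := ⟨LinearMap.id, fun m => by
    rw [LinearMap.id_apply]
    induction M.coaction m using NCTensor.induction_on with
    | tmul m n => rfl
    | add s t hs ht => rw [map_add, ← hs, ← ht]⟩
  comp f g := ⟨g.toLin ∘ₗ f.toLin, fun m => by
    rw [LinearMap.comp_apply, g.colinear, f.colinear]
    induction RightComodule.coaction _ m using NCTensor.induction_on with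
    | tmul m n => rfl
    | add s t hs ht => rw [map_add, map_add, map_add, hs, ht]⟩

@[ext]
theorem hom_ext {M N : RightComodule 𝒞} {f g : M ⟶ N} (h : ∀ m, f.toLin m = g.toLin m) : f = g :=
  Hom.ext (LinearMap.ext h)

theorem id_toLin (M : RightComodule 𝒞) (m : M.carrier) : Hom.toLin (𝟙 M) m = m := rfl

theorem comp_toLin {M N P : RightComodule 𝒞} (f : M ⟶ N) (g : N ⟶ P) (m : M.carrier) :
    (f ≫ g).toLin m = g.toLin (f.toLin m) := rfl

/-- The coinvariants `M^{co C} = {m | ρ(m) = m ⊗ x}`, as a right `B`-submodule of `M`. -/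
def coinvariants (x : 𝒞.Grouplike) (M : RightComodule 𝒞) :
    Submodule (x.coinv)ᵐᵒᵖ M.carrier where
  carrier := {m | M.coaction m = tmul A m x.val}
  add_mem' {m n} hm hn := by
    simp only [Set.mem_ofPred_eq] at *
    rw [map_add, hm, hn, add_tmul]
  zero_mem' := by
    change M.coaction 0 = _
    rw [map_zero]
    exact (map_zero (AddMonoidHom.mk' (fun m : M.carrier => tmul A m x.val)
      (fun m n => add_tmul m n x.val))).symm
  smul_mem' b m hm := by
    change M.coaction (op ((unop b).1 : A) • m) = tmul A (op ((unop b).1 : A) • m) x.val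
    rw [map_smul, hm, right_smul_tmul, smul_tmul, Grouplike.smul_val (unop b).2]

end RightComodule

namespace Grouplike

variable {𝒞 : Coring A C} (x : 𝒞.Grouplike)

/-- The right `C`-comodule `N ⊗_B A`, with coaction `n ⊗ a ↦ (n ⊗ 1) ⊗ x a`. -/
def induced (N : Type u) [AddCommGroup N] [Module (x.coinv)ᵐᵒᵖ N] : RightComodule 𝒞 where
  carrier := NCTensor x.coinv N A
  coaction :=
    { toFun := NCTensor.lift (fun n a => tmul A (tmul x.coinv n (1 : A)) (op a • x.val))
        (fun n n' a => by rw [add_tmul, add_tmul])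
        (fun n a a' => by rw [MulOpposite.op_add, add_smul, tmul_add])
        (fun n b a => by
          rw [smul_tmul, Subring.smul_def, Subring.smul_def, smul_eq_mul, smul_eq_mul, mul_one,
            MulOpposite.op_mul, mul_smul, ← smul_val b.2, ← smul_comm (b : A), ← smul_tmul, right_smul_tmul,
            op_smul_eq_mul, one_mul])
      map_add' := map_add _
      map_smul' := fun a t => by
        induction t using NCTensor.induction_on with
        | tmul n a' => exact congrArg (tmul A _) (mul_smul a (op a') x.val)
        | add s t hs ht => rw [smul_add, map_add, map_add, hs, ht, smul_add] }
  coassoc t := by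
    induction t using NCTensor.induction_on with
    | tmul n a =>
      change tmul A (tmul x.coinv n (1 : A)) (tmul A (op (1 : A) • x.val) (op a • x.val)) =
        tmul A (tmul x.coinv n (1 : A)) (𝒞.comul.left (op a • x.val))
      rw [comul_op_smul_val, MulOpposite.op_one, one_smul]
    | add s t hs ht => simp only [map_add, hs, ht]
  map_id_counit t := by
    induction t using NCTensor.induction_on with
    | tmul n a =>
      change tmul x.coinv n (op (𝒞.counit.left (op a • x.val)) • (1 : A)) = tmul x.coinv n a
      rw [counit_op_smul, x.counit_val, one_mul, op_smul_eq_mul, one_mul]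
    | add s t hs ht => simp only [map_add, hs, ht]

theorem induced_coaction_tmul (N : Type u) [AddCommGroup N] [Module (x.coinv)ᵐᵒᵖ N] (n : N)
    (a : A) : (x.induced N).coaction (tmul x.coinv n a) =
      tmul A (tmul x.coinv n (1 : A)) (op a • x.val) := rfl

variable {x} in
theorem induced_hom_ext {N : Type u} [AddCommGroup N] [Module (x.coinv)ᵐᵒᵖ N]
    {M : RightComodule 𝒞} {f g : x.induced N ⟶ M}
    (h : ∀ n a, f.toLin (tmul x.coinv n a) = g.toLin (tmul x.coinv n a)) : f = g := by
  ext t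
  change NCTensor x.coinv N A at t
  exact DFunLike.congr_fun (NCTensor.hom_ext (f := f.toLin.toAddMonoidHom)
    (g := g.toLin.toAddMonoidHom) h) t

/-- `f ⊗ A` as a right `A`-linear map. -/
def mapRight {N N' : Type u} [AddCommGroup N] [Module (x.coinv)ᵐᵒᵖ N] [AddCommGroup N']
    [Module (x.coinv)ᵐᵒᵖ N'] (f : N →ₗ[(x.coinv)ᵐᵒᵖ] N') :
    NCTensor x.coinv N A →ₗ[Aᵐᵒᵖ] NCTensor x.coinv N' A where
  toFun := NCTensor.map f (LinearMap.id : A →ₗ[x.coinv] A)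
  map_add' := map_add _
  map_smul' a t := by
    induction t using NCTensor.induction_on with
    | tmul n a' => rfl
    | add s t hs ht => rw [smul_add, map_add, map_add, hs, ht, smul_add]

/-- `f ⊗ A` as a colinear map. -/
def inducedMap {N N' : Type u} [AddCommGroup N] [Module (x.coinv)ᵐᵒᵖ N] [AddCommGroup N']
    [Module (x.coinv)ᵐᵒᵖ N'] (f : N →ₗ[(x.coinv)ᵐᵒᵖ] N') : x.induced N ⟶ x.induced N' where
  toLin := x.mapRight f
  colinear t := by
    change NCTensor x.coinv N A at t
    induction t using NCTensor.induction_on with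
    | tmul n a => rfl
    | add s t hs ht =>
      refine (congrArg _ (map_add (x.mapRight f) s t)).trans ((map_add _ _ _).trans ?_)
      refine (congrArg₂ (· + ·) hs ht).trans ((map_add _ _ _).symm.trans (congrArg _ ?_))
      exact (map_add (x.induced N).coaction s t).symm

/-- The functor `F = - ⊗_B A` from right `B`-modules to right `C`-comodules. -/
def F : ModuleCat.{u} (x.coinv)ᵐᵒᵖ ⥤ RightComodule 𝒞 where
  obj N := x.induced N
  map f := x.inducedMap f.hom
  map_id _ := induced_hom_ext fun _ _ => rfl
  map_comp _ _ := induced_hom_ext fun _ _ => rfl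

/-- The functor `G = (-)^{co C}` from right `C`-comodules to right `B`-modules. -/
def G : RightComodule 𝒞 ⥤ ModuleCat.{u} (x.coinv)ᵐᵒᵖ where
  obj M := ModuleCat.of _ (M.coinvariants x)
  map {M N} f := ModuleCat.ofHom
    { toFun := fun m => ⟨f.toLin m, by
        change N.coaction (f.toLin m.1) = tmul A (f.toLin m.1) x.val
        have hm : M.coaction m.1 = tmul A m.1 x.val := m.2
        rw [f.colinear, hm, map_tmul, LinearMap.id_apply]⟩
      map_add' := fun m n => Subtype.ext (map_add f.toLin m.1 n.1)
      map_smul' := fun b m => Subtype.ext (map_smul f.toLin (op ((unop b).1 : A)) m.1) }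
  map_id M := by ext m; rfl
  map_comp f g := by ext m; rfl

/-- The unit `ν_N : N → (N ⊗_B A)^{co C}`, `n ↦ n ⊗ 1`. -/
def unit : 𝟭 (ModuleCat.{u} (x.coinv)ᵐᵒᵖ) ⟶ x.F ⋙ x.G where
  app N := ModuleCat.ofHom
    { toFun := fun n => ⟨tmul x.coinv n (1 : A), by
        exact congrArg (tmul A (tmul x.coinv n (1 : A))) (one_smul Aᵐᵒᵖ x.val)⟩
      map_add' := fun n n' => Subtype.ext (add_tmul n n' (1 : A))
      map_smul' := fun b n => Subtype.ext (by
        change tmul x.coinv (op (unop b) • n) (1 : A) = tmul x.coinv n ((1 : A) * ((unop b).1 : A))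
        rw [smul_tmul, Subring.smul_def, smul_eq_mul, one_mul, mul_one]) }
  naturality _ _ _ := by ext n; rfl

/-- `M^{co C} ⊗_B A → M`, `m ⊗ a ↦ m a`, as a right `A`-linear map. -/
def counitLin (M : RightComodule 𝒞) :
    NCTensor x.coinv (M.coinvariants x) A →ₗ[Aᵐᵒᵖ] M.carrier where
  toFun := NCTensor.lift (fun m a => op a • m.1)
    (fun m m' a => smul_add _ _ _)
    (fun m a a' => by rw [MulOpposite.op_add, add_smul])
    (fun m b a => by
      rw [Subring.smul_def, smul_eq_mul, MulOpposite.op_mul, mul_smul]; rfl)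
  map_add' := map_add _
  map_smul' a t := by
    induction t using NCTensor.induction_on with
    | tmul m a' => exact mul_smul a (op a') m.1
    | add s t hs ht => rw [smul_add, map_add, map_add, hs, ht, smul_add]

/-- `M^{co C} ⊗_B A → M`, `m ⊗ a ↦ m a`, as a colinear map. -/
def counitHom (M : RightComodule 𝒞) : x.induced (M.coinvariants x) ⟶ M where
  toLin := x.counitLin M
  colinear t := by
    change NCTensor x.coinv (M.coinvariants x) A at t
    induction t using NCTensor.induction_on with
    | tmul m a =>
      have hm : M.coaction m.1 = tmul A m.1 x.val := m.2
      change M.coaction (op a • m.1) = tmul A (op (1 : A) • m.1) (op a • x.val)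
      rw [map_smul, hm, MulOpposite.op_one, one_smul, right_smul_tmul]
    | add s t hs ht =>
      refine (congrArg _ (map_add (x.counitLin M) s t)).trans ((map_add _ _ _).trans ?_)
      refine (congrArg₂ (· + ·) hs ht).trans ((map_add _ _ _).symm.trans (congrArg _ ?_))
      exact (map_add (x.induced (M.coinvariants x)).coaction s t).symm

/-- The counit `ζ_M : M^{co C} ⊗_B A → M`, `m ⊗ a ↦ m a`. -/
def counit : x.G ⋙ x.F ⟶ 𝟭 (RightComodule 𝒞) where
  app M := x.counitHom M
  naturality M N f := induced_hom_ext (N := M.coinvariants x) fun m a =>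
    (map_smul f.toLin (op a) m.1).symm

/-- The adjunction between `F` and `G`. -/
def adjunction : x.F ⊣ x.G where
  unit := x.unit
  counit := x.counit
  left_triangle_components _ := induced_hom_ext fun n a =>
    congrArg (tmul x.coinv n) (one_mul a)
  right_triangle_components M := by
    ext m
    exact Subtype.ext (one_smul Aᵐᵒᵖ m.1)

/-- `(F, G)` is an equivalence of categories: the unit and the counit of the adjunction are
isomorphisms. -/
def IsEquivalencePair : Prop :=
  IsIso x.adjunction.unit ∧ IsIso x.adjunction.counit

end Grouplike

end Coring

end

end GaloisCoring

/-! The statements are joined in the cycle 1 → 4 → 3 → 2 → 1.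

1 → 4 is faithfully flat descent. If b is in B, then 1 ⊗ b and b ⊗ 1 have the same image bx = xb
under can', hence agree in A ⊗_{B'} A; exactness of N → N ⊗ A ⇉ N ⊗ A ⊗ A at N = B' puts b in B'.
With B = B', bijectivity of can' makes θ : M ⊗_B A → M ⊗_A C, m ⊗ a ↦ m ⊗ xa, bijective for every
right A-module M (`bijective_theta`). Through θ a coaction is a descent datum: the unit is bijective
by the exact sequence (`exact_amitsur`), and the counit because - ⊗_B A preserves the kernel M^{co
C} of m ↦ ρ(m) - m ⊗ x.

4 → 3 tests the equivalence on two kinds of object. Since C is finitely generated projective, *C is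
a right C-comodule whose coinvariants lie in Q, so surjectivity of the counit there puts 1 in the
image of μ. Injectivity of the unit at B/I, where I = {q(x) | q ∈ Q}, then forces 1 ∈ I, so 1 is a
value of τ. A Morita map that takes the value 1 is bijective.

3 → 2 is Morita theory. Writing 1 = ∑ qᵢ # i(aᵢ) and evaluating at xb gives the dual basis b = ∑
qᵢ(xb) aᵢ of A over B, while 1 = τ(…) gives the generator property. The same expansion of 1 shows
that *can' is bijective.

2 → 1 dualizes back. A dual basis (eᵢ, φᵢ) of A over B' lifts along *can' to functionals hᵢ on C,
and d ↦ ∑ hᵢ(d) ⊗ eᵢ inverts can'. Faithful flatness holds for every progenerator. -/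

namespace GaloisCoring

open scoped TensorProduct
open MulOpposite (op unop)
open CategoryTheory (Category IsIso Functor)
open scoped CategoryTheory
open NCTensor

noncomputable section

/-! ### Tensor arithmetic over a noncommutative ring -/

namespace NCTensor

variable {R M N : Type*} [Ring R] [AddCommGroup M] [Module Rᵐᵒᵖ M] [AddCommGroup N] [Module R N]

theorem zero_tmul (n : N) : tmul R (0 : M) n = 0 :=
  map_zero (AddMonoidHom.mk' (fun m : M => tmul R m n) (fun m m' => add_tmul m m' n))

theorem sub_tmul (m m' : M) (n : N) : tmul R (m - m') n = tmul R m n - tmul R m' n :=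
  map_sub (AddMonoidHom.mk' (fun m : M => tmul R m n) (fun m m' => add_tmul m m' n)) m m'

theorem tmul_sum {ι : Type*} (s : Finset ι) (m : M) (n : ι → N) :
    tmul R m (∑ i ∈ s, n i) = ∑ i ∈ s, tmul R m (n i) :=
  map_sum (AddMonoidHom.mk' (fun n : N => tmul R m n) (tmul_add m)) n s

/-- Every tensor is a finite sum of pure tensors. -/
theorem exists_sum (t : NCTensor R M N) :
    ∃ (k : ℕ) (m : Fin k → M) (n : Fin k → N), t = ∑ i, tmul R (m i) (n i) := by
  induction t using NCTensor.induction_on with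
  | tmul m n => exact ⟨1, fun _ => m, fun _ => n, by simp⟩
  | add s t hs ht =>
    obtain ⟨k, m, n, rfl⟩ := hs
    obtain ⟨l, m', n', rfl⟩ := ht
    refine ⟨k + l, Fin.append m m', Fin.append n n', ?_⟩
    rw [Fin.sum_univ_add]
    simp

end NCTensor

/-! ### Dual bases, and faithful flatness of progenerators -/

section DualBasis

variable {R M M' N : Type*} [Ring R] [AddCommGroup M] [Module Rᵐᵒᵖ M] [AddCommGroup M']
  [Module Rᵐᵒᵖ M'] [AddCommGroup N] [Module R N]

theorem contract_map (φ : N →ₗ[R] R) (g : M →ₗ[Rᵐᵒᵖ] M') (t : NCTensor R M N) :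
    contract φ (map g LinearMap.id t) = g (contract φ t) := by
  induction t using NCTensor.induction_on with
  | tmul m n => simp
  | add s t hs ht => simp only [map_add, hs, ht]

/-- N is a retract of some R^k: the eᵢ are the images of the standard basis, the φᵢ the coordinates
of the section. -/
theorem exists_dual_basis (R N : Type*) [Ring R] [AddCommGroup N] [Module R N]
    [Module.Finite R N] [Module.Projective R N] :
    ∃ (k : ℕ) (e : Fin k → N) (φ : Fin k → N →ₗ[R] R), ∀ n, ∑ i, φ i n • e i = n := by
  obtain ⟨k, f, g, -, -, hfg⟩ := Module.Finite.exists_comp_eq_id_of_projective R N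
  refine ⟨k, fun i => f (Pi.single i 1), fun i => LinearMap.proj i ∘ₗ g, fun n => ?_⟩
  conv_rhs => rw [← LinearMap.id_apply (R := R) n, ← hfg, LinearMap.comp_apply,
    LinearMap.pi_apply_eq_sum_univ f (g n)]
  refine Finset.sum_congr rfl fun i _ => ?_
  simp only [LinearMap.comp_apply, LinearMap.proj_apply]
  congr 2
  funext j
  simp [Pi.single_apply, eq_comm]

/-- The first identity splits R^k → N. The second says that N^l → R takes the value 1, which by left
linearity makes it surjective. -/
theorem isProgenerator_of_dual_basis {k l : ℕ} {e : Fin k → N} {φ : Fin k → N →ₗ[R] R}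
    (h : ∀ n, ∑ i, φ i n • e i = n) {e' : Fin l → N} {ψ : Fin l → N →ₗ[R] R}
    (h' : ∑ i, ψ i (e' i) = 1) : IsProgenerator R N where
  finite := by
    classical
    refine ⟨⟨Finset.univ.image e, eq_top_iff.2 fun n _ => ?_⟩⟩
    rw [← h n]
    exact Submodule.sum_mem _ fun i _ => Submodule.smul_mem _ _
      (Submodule.subset_span (by simp))
  projective := by
    refine Module.Projective.of_split (M := Fin k → R) (LinearMap.pi φ)
      (Fintype.linearCombination R e) ?_
    ext n
    simpa [Fintype.linearCombination_apply] using h n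
  generator := by
    refine ⟨l, ∑ i, ψ i ∘ₗ LinearMap.proj i, fun r => ⟨fun i => r • e' i, ?_⟩⟩
    simp only [LinearMap.sum_apply, LinearMap.comp_apply, LinearMap.proj_apply, map_smul,
      smul_eq_mul]
    rw [← Finset.mul_sum, h', mul_one]

theorem IsProgenerator.exists_dual_basis (h : IsProgenerator R N) :
    ∃ (k : ℕ) (e : Fin k → N) (φ : Fin k → N →ₗ[R] R), ∀ n, ∑ i, φ i n • e i = n :=
  have := h.finite
  have := h.projective
  GaloisCoring.exists_dual_basis R N

theorem IsProgenerator.exists_sum_eq_one (h : IsProgenerator R N) :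
    ∃ (l : ℕ) (e : Fin l → N) (ψ : Fin l → N →ₗ[R] R), ∑ i, ψ i (e i) = 1 := by
  obtain ⟨l, g, hg⟩ := h.generator
  obtain ⟨e, he⟩ := hg 1
  refine ⟨l, e, fun i => g ∘ₗ LinearMap.single R (fun _ => N) i, ?_⟩
  rw [← he]
  conv_rhs => rw [← Finset.univ_sum_single e, map_sum]
  rfl

theorem eq_sum_contract {k : ℕ} {e : Fin k → N} {φ : Fin k → N →ₗ[R] R}
    (h : ∀ n, ∑ i, φ i n • e i = n) (t : NCTensor R M N) :
    t = ∑ i, tmul R (contract (φ i) t) (e i) := by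
  induction t using NCTensor.induction_on with
  | tmul m n =>
    simp only [contract_tmul, smul_tmul]
    rw [← tmul_sum, h]
  | add s t hs ht =>
    simp only [map_add, add_tmul, Finset.sum_add_distrib]
    rw [← hs, ← ht]

/-- For a finitely generated projective left module `N`, elements of `M ⊗_R N` are separated by
the functionals of `N`. -/
theorem tensor_ext_contract {k : ℕ} {e : Fin k → N} {φ : Fin k → N →ₗ[R] R}
    (h : ∀ n, ∑ i, φ i n • e i = n) {s t : NCTensor R M N}
    (hst : ∀ f : N →ₗ[R] R, contract f s = contract f t) : s = t := by
  rw [eq_sum_contract h s, eq_sum_contract h t]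
  simp only [hst]

end DualBasis

/-- Progenerators are faithfully flat. -/
theorem IsProgenerator.isFaithfullyFlat {R N : Type u} [Ring R] [AddCommGroup N] [Module R N]
    (h : IsProgenerator R N) : IsFaithfullyFlat R N := by
  intro M₁ M₂ M₃ _ _ _ _ _ _ f g
  obtain ⟨k, e, φ, he⟩ := h.exists_dual_basis
  obtain ⟨l, e', ψ, he'⟩ := h.exists_sum_eq_one
  -- The generator property recovers m from the tensors m ⊗ e'ᵢ, so exactness can be reflected; the
  -- dual basis serves to preserve it.
  have hψ : ∀ m : M₂, ∑ i, contract (ψ i) (tmul R m (e' i)) = m := fun m => by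
    simp only [contract_tmul]
    rw [← Finset.sum_smul, ← Finset.op_sum, he', MulOpposite.op_one, one_smul]
  constructor
  · intro hfg t
    constructor
    · intro ht
      -- Each coordinate of t lies in ker g, so it lifts along f; the lifts are reassembled against
      -- the eᵢ.
      have : ∀ i, ∃ n, f n = contract (φ i) t := fun i =>
        (hfg _).1 (by rw [← contract_map, ht, map_zero])
      choose n hn using this
      refine ⟨∑ i, tmul R (n i) (e i), ?_⟩
      rw [map_sum, eq_sum_contract he t]
      simp [hn]
    · rintro ⟨t, rfl⟩
      induction t using NCTensor.induction_on with
      | tmul m n => rw [map_tmul, map_tmul, hfg.apply_apply_eq_zero, zero_tmul]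
      | add s t hs ht => rw [map_add, map_add, hs, ht, add_zero]
  · intro hfg m
    constructor
    · intro hm
      have : ∀ i, ∃ t, map f LinearMap.id t = tmul R m (e' i) := fun i =>
        (hfg _).1 (by rw [map_tmul, hm, zero_tmul])
      choose t ht using this
      refine ⟨∑ i, contract (ψ i) (t i), ?_⟩
      rw [map_sum, ← hψ m]
      simp only [← contract_map, ht]
    · rintro ⟨m, rfl⟩
      rw [← hψ (f m), map_sum]
      refine Finset.sum_eq_zero fun i _ => ?_
      rw [← contract_map, ← LinearMap.id_apply (R := R) (e' i), ← map_tmul,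
        hfg.apply_apply_eq_zero, map_zero]

/-! ### Morita contexts whose maps take the value 1 -/

section Morita

variable {R S P Q : Type*} [Ring R] [Ring S] [AddCommGroup P] [Module R P]
    [Module Sᵐᵒᵖ P] [SMulCommClass R Sᵐᵒᵖ P] [AddCommGroup Q] [Module S Q] [Module Rᵐᵒᵖ Q]
    [SMulCommClass S Rᵐᵒᵖ Q] (m : MoritaContext R S P Q)

/-- For s = p ⊗ q and t = p' ⊗ q', both sides are p ⊗ μ(q ⊗ p') q', with μ(q ⊗ p') moved across the
tensor. -/
theorem MoritaContext.τ_op_smul_comm (s t : NCTensor S P Q) :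
    op (m.τ t) • s = m.τ s • t := by
  induction s using NCTensor.induction_on with
  | tmul p q =>
    induction t using NCTensor.induction_on with
    | tmul p' q' =>
      rw [right_smul_tmul, left_smul_tmul, ← m.μ_smul_eq, m.τ_smul_eq, smul_tmul]
    | add t t' ht ht' => rw [map_add, MulOpposite.op_add, add_smul, ht, ht', smul_add]
  | add s s' hs hs' => rw [smul_add, hs, hs', map_add, add_smul]

/-- If the map `τ` of a Morita context is surjective, then it is bijective. -/
theorem MoritaContext.bijective_τ {t : NCTensor S P Q} (ht : m.τ t = 1) :
    Function.Bijective m.τ := by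
  refine ⟨(injective_iff_map_eq_zero _).2 fun s hs => ?_, fun r => ⟨r • t, ?_⟩⟩
  -- With τ(t) = 1 this reads s = s τ(t) = τ(s) t, which vanishes with τ(s).
  · have := m.τ_op_smul_comm s t
    rwa [ht, hs, zero_smul, MulOpposite.op_one, one_smul] at this
  · rw [m.τ_smul, ht, mul_one]

/-- The opposite Morita context, with the two rings exchanged. -/
def MoritaContext.swap : MoritaContext S R Q P where
  τ := m.μ
  τ_smul := m.μ_smul
  τ_op_smul := m.μ_op_smul
  μ := m.τ
  μ_smul := m.τ_smul
  μ_op_smul := m.τ_op_smul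
  τ_smul_eq := m.μ_smul_eq
  μ_smul_eq := m.τ_smul_eq

theorem MoritaContext.isStrict_of_eq_one {s : NCTensor S P Q} (hs : m.τ s = 1)
    {t : NCTensor R Q P} (ht : m.μ t = 1) : m.IsStrict :=
  ⟨m.bijective_τ hs, m.swap.bijective_τ ht⟩

end Morita

/-! ### From *can' back to can', and from strictness to *can' -/

namespace Coring
namespace Grouplike
open LeftDual

variable {A C : Type u} [Ring A] [AddCommGroup C] [Module A C] [Module Aᵐᵒᵖ C]
  [SMulCommClass A Aᵐᵒᵖ C] {𝒞 : Coring A C} (x : 𝒞.Grouplike)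

/-- The inverse of can' is d ↦ ∑ hᵢ(d) ⊗ eᵢ. Surjectivity of *can' supplies the hᵢ; injectivity of
*can' shows that this is also a right inverse. -/
theorem bijective_can_of_bijective_dualCan (hC : IsProgenerator A C) (B' : Subring A)
    (hB' : B' ≤ x.coinv) (hd : Function.Bijective (x.dualCan B' hB'))
    (hA : IsProgenerator B' A) : Function.Bijective (x.can B' hB').left := by
  obtain ⟨k, e, φ, he⟩ := hA.exists_dual_basis
  obtain ⟨l, c, f, hc⟩ := hC.exists_dual_basis
  -- Each φᵢ, followed by the inclusion B' → A, is a B'-endomorphism of A and so comes from *C.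
  have : ∀ i, ∃ h : 𝒞.LeftDual, ∀ a : A, h.toLin (op a • x.val) = (φ i a : A) := fun i => by
    obtain ⟨h, hh⟩ := hd.2 (op
      { toFun := fun a => (φ i a : A)
        map_add' := fun a a' => by rw [map_add]; rfl
        map_smul' := fun b a => by rw [map_smul]; rfl })
    refine ⟨h, fun a => ?_⟩
    rw [← x.dualCan_apply B' hB', hh]; rfl
  choose h hh using this
  have hleft : ∀ t, ∑ i, tmul B' ((h i).toLin ((x.can B' hB').left t)) (e i) = t := by
    intro t
    induction t using NCTensor.induction_on with
    | tmul a a' =>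
      simp only [x.can_tmul, map_smul, hh, smul_eq_mul]
      have : ∀ i, tmul B' (a * (φ i a' : A)) (e i) = tmul B' a (φ i a' • e i) := fun i => by
        rw [← smul_tmul]; rfl
      simp only [this]
      rw [← tmul_sum, he]
    | add s t hs ht =>
      simp only [map_add, add_tmul, Finset.sum_add_distrib]
      rw [hs, ht]
  refine ⟨fun s t hst => by rw [← hleft s, ← hleft t, hst], fun d => ?_⟩
  refine ⟨∑ i, tmul B' ((h i).toLin d) (e i), ?_⟩
  -- p is can' after its left inverse, and it fixes every xa. *can' only sees the elements xa, so
  -- its injectivity gives g ∘ p = g for every functional g; these separate points of C, hence p =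
  -- id.
  let p : C →ₗ[A] C := ∑ i, (h i).toLin.smulRight (op (e i) • x.val)
  have hp : ∀ d, p d = ∑ i, (h i).toLin d • op (e i) • x.val := fun d => by
    simp [p]
  have hpx : ∀ a : A, p (op a • x.val) = op a • x.val := fun a => by
    have := congrArg (x.can B' hB').left (hleft (tmul B' 1 a))
    rw [x.can_tmul, one_smul, map_sum] at this
    rw [hp]
    exact this
  have hfp : ∀ g : C →ₗ[A] A, ∀ d, g (p d) = g d := fun g d => by
    have : (ofLin (g ∘ₗ p) : 𝒞.LeftDual) = ofLin g := hd.1 (MulOpposite.unop_injective (by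
      ext a
      rw [dualCan_apply, dualCan_apply]
      exact congrArg g (hpx a)))
    exact congrArg (fun k : 𝒞.LeftDual => k.toLin d) this
  have : p d = d := by
    refine (hc (p d)).symm.trans (Eq.trans ?_ (hc d))
    simp only [hfp]
  rw [map_sum]
  exact (hp d).symm.trans this

variable {x} in
-- All claims come from expanding 1 through μ, except the generator property, which comes from
-- expanding 1 through τ.
theorem progenerator_of_isStrict (h : x.moritaContext.IsStrict) :
    Function.Bijective (x.dualCan x.coinv le_rfl) ∧ IsProgenerator x.coinv A := by
  obtain ⟨⟨-, hτ⟩, ⟨-, hμ⟩⟩ := h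
  obtain ⟨s, hs⟩ := hτ 1
  obtain ⟨t, ht⟩ := hμ 1
  obtain ⟨l, a', q', rfl⟩ := exists_sum s
  obtain ⟨k, q, a, rfl⟩ := exists_sum t
  have hs : ∑ i, x.moritaτ (tmul 𝒞.LeftDual (a' i) (q' i)) = 1 := by
    rw [← map_sum]; exact hs
  have ht : ∑ i, (q i).1 * 𝒞.toLeftDual (ofBase (a i)) = 1 := by
    have ht' : x.moritaμ (∑ i, tmul x.coinv (q i) (a i)) = 1 := ht
    rwa [map_sum] at ht'
  have hsum : ∀ {n : ℕ} (f : Fin n → 𝒞.LeftDual) (c : C),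
      (∑ i, f i).toLin c = ∑ i, (f i).toLin c := fun f c =>
    map_sum (AddMonoidHom.mk' (fun f : 𝒞.LeftDual => f.toLin c) fun _ _ => rfl) f _
  have ht' : ∀ c, ∑ i, (q i).1.toLin c * ofBase (a i) = 𝒞.counit.left c := fun c => by
    rw [← one_toLin, ← ht, hsum]
    simp only [mul_toLeftDual_apply]
  let τ₁ (q : x.Q) : A →ₗ[x.coinv] x.coinv :=
    { toFun := fun a => x.moritaτ (tmul 𝒞.LeftDual (x.toBase a) q)
      map_add' := fun a a' => by rw [← map_add, ← add_tmul]; rfl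
      map_smul' := fun b a => x.moritaContext.τ_smul b (tmul 𝒞.LeftDual (x.toBase a) q) }
  have hbasis : ∀ b : A, ∑ i, τ₁ (q i) b • ofBase (a i) = b := fun b => by
    have := ht' (op b • x.val)
    rwa [counit_op_smul, x.counit_val, one_mul] at this
  refine ⟨⟨fun f g hfg => ?_, fun φ => ?_⟩,
    isProgenerator_of_dual_basis hbasis (e' := fun i => ofBase (a' i)) (ψ := fun i => τ₁ (q' i)) hs⟩
  -- f = ∑ qᵢ # i(aᵢ) # f = ∑ qᵢ # i(f(x aᵢ)) depends only on the values of f on the elements xa.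
  · have hx : ∀ b : A, f.toLin (op b • x.val) = g.toLin (op b • x.val) := fun b => by
      rw [← x.dualCan_apply _ le_rfl, hfg, x.dualCan_apply]
    rw [← one_mul f, ← one_mul g, ← ht, Finset.sum_mul, Finset.sum_mul]
    simp only [x.mul_toLeftDual_mul, hx]
  -- The preimage is forced by the previous formula, with f(x aᵢ) replaced by φ(aᵢ).
  · refine ⟨∑ i, (q i).1 * 𝒞.toLeftDual (φ.unop (ofBase (a i))), MulOpposite.unop_injective ?_⟩
    ext b
    rw [dualCan_apply, hsum]
    simp only [mul_toLeftDual_apply]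
    conv_rhs => rw [← hbasis b, map_sum]
    simp only [map_smul]
    rfl

end Grouplike
end Coring


/-! ### Componentwise form of the equivalence -/

namespace Coring

variable {A C : Type u} [Ring A] [AddCommGroup C] [Module A C] [Module Aᵐᵒᵖ C]
  [SMulCommClass A Aᵐᵒᵖ C] {𝒞 : Coring A C}

/-- The linear inverse of a bijective colinear map is automatically colinear. -/
theorem RightComodule.isIso_iff_bijective {M N : RightComodule 𝒞} (f : M ⟶ N) :
    IsIso f ↔ Function.Bijective f.toLin := by
  constructor
  · intro h
    refine Function.bijective_iff_has_inverse.2 ⟨(CategoryTheory.inv f).toLin, fun m => ?_,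
      fun n => ?_⟩
    · rw [← RightComodule.comp_toLin, IsIso.hom_inv_id, RightComodule.id_toLin]
    · rw [← RightComodule.comp_toLin, IsIso.inv_hom_id, RightComodule.id_toLin]
  · intro h
    let e := LinearEquiv.ofBijective f.toLin h
    have he : ∀ m, e m = f.toLin m := fun _ => rfl
    have hes : ∀ n, f.toLin (e.symm n) = n := e.apply_symm_apply
    let g : N ⟶ M := ⟨e.symm.toLinearMap, fun n => by
      have h1 : N.coaction n = map f.toLin LinearMap.id (M.coaction (e.symm n)) := by
        rw [← f.colinear, hes]
      change M.coaction (e.symm n) = _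
      rw [h1]
      induction M.coaction (e.symm n) using NCTensor.induction_on with
      | tmul m c =>
        change tmul A m c = tmul A (e.symm (e m)) c
        rw [e.symm_apply_apply]
      | add s t hs ht => rw [map_add, map_add, ← hs, ← ht]⟩
    exact ⟨g, RightComodule.hom_ext e.symm_apply_apply, RightComodule.hom_ext e.apply_symm_apply⟩

theorem Grouplike.isEquivalencePair_iff (x : 𝒞.Grouplike) :
    x.IsEquivalencePair ↔
      (∀ N : ModuleCat.{u} (x.coinv)ᵐᵒᵖ, Function.Bijective (x.unit.app N).hom) ∧
        ∀ M : RightComodule 𝒞, Function.Bijective (x.counitLin M) := by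
  refine and_congr ?_ ?_
  · refine (CategoryTheory.NatTrans.isIso_iff_isIso_app x.unit).trans
      (forall_congr' fun N => ?_)
    exact CategoryTheory.ConcreteCategory.isIso_iff_bijective (x.unit.app N)
  · refine (CategoryTheory.NatTrans.isIso_iff_isIso_app x.counit).trans
      (forall_congr' fun M => ?_)
    exact RightComodule.isIso_iff_bijective (x.counitHom M)

open LeftDual

/-- Right multiplication by an element of `A`, as a left linear map. -/
def rightMul (C : Type u) [AddCommGroup C] [Module A C] [Module Aᵐᵒᵖ C] [SMulCommClass A Aᵐᵒᵖ C]
    (a : A) : C →ₗ[A] C where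
  toFun c := op a • c
  map_add' := smul_add _
  map_smul' b c := (smul_comm b (op a) c).symm

/-! ### Contraction against functionals -/

section Contract

variable {M : Type u} [AddCommGroup M] [Module Aᵐᵒᵖ M]

theorem contract_op_smul (g : C →ₗ[A] A) (a : A) (t : NCTensor A M C) :
    contract g (op a • t) = contract (g ∘ₗ rightMul C a) t := by
  induction t using NCTensor.induction_on with
  | tmul m c => rfl
  | add s t hs ht => simp only [smul_add, map_add, hs, ht]

theorem contract_dual_op_smul (s : 𝒞.LeftDual) (a : A) (t : NCTensor A M C) :
    contract (op a • s).toLin t = op a • contract s.toLin t := by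
  induction t using NCTensor.induction_on with
  | tmul m c => rw [contract_tmul, contract_tmul, smul_smul, ← MulOpposite.op_mul]; rfl
  | add s t hs ht => simp only [smul_add, map_add, hs, ht]

/-- The functional on the right is the product g # f, so comultiplying and contracting twice is
contracting once with a product in *C. -/
theorem contract_contract_comul (f g : C →ₗ[A] A) (t : NCTensor A M C) :
    contract f (contract g ((assoc A A M C C).symm (map LinearMap.id 𝒞.comul.left t))) =
      contract (f ∘ₗ 𝒞.coact g) t := by
  induction t using NCTensor.induction_on with
  | tmul m c =>
    rw [map_tmul, contract_tmul, LinearMap.comp_apply, coact_apply, LinearMap.id_apply]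
    induction 𝒞.comul.left c using NCTensor.induction_on with
    | tmul d e =>
      rw [show (assoc A A M C C).symm (tmul A m (tmul A d e)) = tmul A (tmul A m d) e from rfl]
      rfl
    | add s t hs ht =>
      rw [tmul_add, map_add, map_add, map_add, hs, ht, map_add, map_add, MulOpposite.op_add,
        add_smul]
  | add s t hs ht => simp only [map_add, hs, ht]

end Contract

/-! ### The left dual as a right comodule -/

section DualComodule

variable {k : ℕ} {c : Fin k → C} {f : Fin k → C →ₗ[A] A}

/-- The coaction `s ↦ ∑ (s # fᵢ) ⊗ cᵢ` on the left dual of a finitely generated projective coring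
with dual basis `(cᵢ, fᵢ)`. -/
def dualCoaction (𝒞 : Coring A C) (c : Fin k → C) (f : Fin k → C →ₗ[A] A) :
    𝒞.LeftDual →+ NCTensor A 𝒞.LeftDual C where
  toFun s := ∑ i, tmul A (s * ofLin (f i)) (c i)
  map_zero' := by simp [zero_tmul]
  map_add' s t := by simp only [add_mul, add_tmul, Finset.sum_add_distrib]

theorem dualCoaction_apply (s : 𝒞.LeftDual) :
    dualCoaction 𝒞 c f s = ∑ i, tmul A (s * ofLin (f i)) (c i) := rfl

/-- This determines the coaction without reference to the chosen dual basis: its contractions are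
right multiplications in *C. It follows by expanding d₁ s(d₂) in the basis inside g. -/
theorem contract_dualCoaction (h : ∀ d, ∑ i, f i d • c i = d) (g : C →ₗ[A] A)
    (s : 𝒞.LeftDual) : contract g (dualCoaction 𝒞 c f s) = s * ofLin g := by
  ext d
  have : (contract g (dualCoaction 𝒞 c f s)) = ∑ i, op (g (c i)) • (s * ofLin (f i)) := by
    rw [dualCoaction_apply, map_sum]
    simp only [contract_tmul]
  rw [this, mul_toLin, toLin_ofLin]
  conv_rhs => rw [← h (contract s.toLin (𝒞.comul.left d)), map_sum]
  refine (map_sum (AddMonoidHom.mk' (fun f : 𝒞.LeftDual => f.toLin d) fun _ _ => rfl) _ _).trans ?_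
  refine Finset.sum_congr rfl fun i _ => ?_
  exact (map_smul g _ (c i)).symm

/-- The left dual of a finitely generated projective coring as a right comodule. -/
def dualComodule (𝒞 : Coring A C) (h : ∀ d, ∑ i, f i d • c i = d) : RightComodule 𝒞 where
  carrier := 𝒞.LeftDual
  coaction :=
    { toFun := dualCoaction 𝒞 c f
      map_add' := map_add _
      map_smul' := fun a s => tensor_ext_contract h fun g => by
        rw [RingHom.id_apply, ← MulOpposite.op_unop a, contract_op_smul, contract_dualCoaction h,
          contract_dualCoaction h]
        ext d
        rw [mul_toLin, mul_toLin, contract_dual_op_smul]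
        rfl }
  coassoc s := by
    -- Testing both C-legs against functionals turns coassociativity into associativity of #.
    rw [← AddEquiv.eq_symm_apply]
    refine tensor_ext_contract h fun g => tensor_ext_contract h fun f' => ?_
    rw [contract_contract_comul, contract_map]
    change contract f' (dualCoaction 𝒞 c f (contract g (dualCoaction 𝒞 c f s))) =
      contract _ (dualCoaction 𝒞 c f s)
    simp only [contract_dualCoaction h]
    exact mul_assoc s (ofLin g) (ofLin f')
  map_id_counit s := (contract_dualCoaction h 𝒞.counit.left s).trans (mul_one s)

end DualComodule

/-! ### From the equivalence to strictness -/

namespace Grouplike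

variable {k : ℕ} {c : Fin k → C} {f : Fin k → C →ₗ[A] A} (x : 𝒞.Grouplike)

/-- Contracting ρ(s) = s ⊗ x with g gives g(d₁ s(d₂)) = s(d) g(x) = g(s(d) x), and the functionals g
separate points of C. -/
theorem mem_Q_of_mem_coinvariants (h : ∀ d, ∑ i, f i d • c i = d) {s : 𝒞.LeftDual}
    (hs : s ∈ (dualComodule 𝒞 h).coinvariants x) : s ∈ x.Q := by
  have hs' : dualCoaction 𝒞 c f s = tmul A s x.val := hs
  intro d
  have hg : ∀ g : C →ₗ[A] A, g (contract s.toLin (𝒞.comul.left d)) = g (s.toLin d • x.val) := by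
    intro g
    have := contract_dualCoaction h g s
    rw [hs', contract_tmul] at this
    have := congrArg (fun u : 𝒞.LeftDual => u.toLin d) this
    rw [map_smul]
    exact this.symm
  refine (h _).symm.trans (Eq.trans ?_ (h _))
  simp only [hg]

/-- Since coinvariants of *C lie in Q, every value of the counit map at *C is a value of μ. -/
theorem exists_moritaμ_eq_one (h : ∀ d, ∑ i, f i d • c i = d)
    (hF : Function.Surjective (x.counitLin (dualComodule 𝒞 h))) : ∃ t, x.moritaμ t = 1 := by
  obtain ⟨u, hu⟩ := hF (1 : 𝒞.LeftDual)
  have key : ∀ u : NCTensor x.coinv ((dualComodule 𝒞 h).coinvariants x) A,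
      ∃ t, x.moritaμ t = x.counitLin (dualComodule 𝒞 h) u := by
    intro u
    induction u using NCTensor.induction_on with
    | tmul s a =>
      exact ⟨tmul x.coinv ⟨s.1, x.mem_Q_of_mem_coinvariants h s.2⟩ (x.toBase a),
        mul_toLeftDual s.1 a⟩
    | add s t hs ht =>
      obtain ⟨s', hs⟩ := hs
      obtain ⟨t', ht⟩ := ht
      exact ⟨s' + t', by rw [map_add, map_add, hs, ht]; rfl⟩
  obtain ⟨t, ht⟩ := key u
  exact ⟨t, ht.trans hu⟩

/-- `q ↦ q(x)` as a right `B`-linear map. -/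
def evalQ : x.Q →ₗ[(x.coinv)ᵐᵒᵖ] x.coinv where
  toFun q := x.moritaτ (tmul 𝒞.LeftDual (x.toBase 1) q)
  map_add' q q' := by rw [tmul_add, map_add]
  map_smul' b q := rfl

theorem coe_evalQ (q : x.Q) : (x.evalQ q : A) = q.1.toLin x.val := by
  refine (x.moritaτ_tmul _ q).trans ?_
  change q.1.toLin (op (1 : A) • x.val) = _
  rw [MulOpposite.op_one, one_smul]

/-- Let I be the right ideal of all q(x). Evaluating 1 = ∑ qᵢ # i(aᵢ) at x gives 1 = ∑ qᵢ(x) aᵢ, so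
the class of 1 in B/I dies in B/I ⊗_B A; injectivity of the unit at B/I yields 1 ∈ I. -/
theorem exists_moritaτ_eq_one {t : NCTensor x.coinv x.Q x.Base} (ht : x.moritaμ t = 1)
    (hF : ∀ N : ModuleCat.{u} (x.coinv)ᵐᵒᵖ, Function.Injective (x.unit.app N).hom) :
    ∃ s, x.moritaτ s = 1 := by
  let I := LinearMap.range x.evalQ
  have key : ∀ t : NCTensor x.coinv x.Q x.Base, tmul x.coinv (I.mkQ 1)
      ((x.moritaμ t).toLin x.val) = 0 := by
    intro t
    induction t using NCTensor.induction_on with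
    | tmul q a =>
      rw [x.moritaμ_tmul, mul_toLeftDual_apply, ← coe_evalQ]
      change tmul x.coinv (I.mkQ 1) (x.evalQ q • ofBase a) = 0
      have hq : I.mkQ (x.evalQ q) = 0 := (Submodule.Quotient.mk_eq_zero I).2 ⟨q, rfl⟩
      rw [← smul_tmul, ← map_smul, op_smul_eq_mul, one_mul, hq]
      exact zero_tmul _
    | add s t hs ht => rw [map_add, add_toLin, tmul_add, hs, ht, add_zero]
  have h1 := key t
  rw [ht, one_toLin, x.counit_val] at h1
  have h2 : I.mkQ 1 = 0 := by
    refine hF (ModuleCat.of _ (x.coinv ⧸ I)) (Subtype.ext ?_)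
    exact h1.trans (zero_tmul (1 : A)).symm
  obtain ⟨q, hq⟩ := (Submodule.Quotient.mk_eq_zero I).1 h2
  exact ⟨tmul 𝒞.LeftDual (x.toBase 1) q, hq⟩

theorem IsEquivalencePair.isStrict {x : 𝒞.Grouplike} (hC : IsProgenerator A C)
    (hF : x.IsEquivalencePair) : x.moritaContext.IsStrict := by
  rw [isEquivalencePair_iff] at hF
  obtain ⟨k, c, f, h⟩ := hC.exists_dual_basis
  obtain ⟨t, ht⟩ := x.exists_moritaμ_eq_one h (hF.2 _).2
  obtain ⟨s, hs⟩ := x.exists_moritaτ_eq_one ht fun N => (hF.1 N).1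
  exact x.moritaContext.isStrict_of_eq_one hs ht

end Grouplike

end Coring


/-! ### Faithful flatness and injectivity -/

section FaithfullyFlat

variable {R N : Type u} [Ring R] [AddCommGroup N] [Module R N]

theorem map_zero_left {M M' : Type*} [AddCommGroup M] [AddCommGroup M'] [Module Rᵐᵒᵖ M]
    [Module Rᵐᵒᵖ M'] (t : NCTensor R M N) :
    map (0 : M →ₗ[Rᵐᵒᵖ] M') (LinearMap.id : N →ₗ[R] N) t = 0 := by
  induction t using NCTensor.induction_on with
  | tmul m n => exact zero_tmul n
  | add s t hs ht => rw [map_add, hs, ht, add_zero]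

theorem IsFaithfullyFlat.injective_iff (h : IsFaithfullyFlat R N) {M M' : Type u} [AddCommGroup M]
    [AddCommGroup M'] [Module Rᵐᵒᵖ M] [Module Rᵐᵒᵖ M'] (f : M →ₗ[Rᵐᵒᵖ] M') :
    Function.Injective f ↔ Function.Injective (map f (LinearMap.id : N →ₗ[R] N)) := by
  -- Injectivity is coded as exactness, with M itself as source of the zero map.
  have h1 : Function.Injective f ↔ Function.Exact (0 : M →ₗ[Rᵐᵒᵖ] M) f := by
    refine (injective_iff_map_eq_zero f).trans ⟨fun hf m => ⟨fun hm => ⟨0, (hf m hm).symm⟩, ?_⟩,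
      fun hf m hm => ?_⟩
    · rintro ⟨m, rfl⟩
      exact map_zero f
    · obtain ⟨m', hm'⟩ := (hf m).1 hm
      exact hm'.symm
  rw [h1, h _ _ _ 0 f, injective_iff_map_eq_zero]
  refine ⟨fun hf t ht => ?_, fun hf t => ⟨fun ht => ⟨0, (hf t ht).symm⟩, ?_⟩⟩
  · obtain ⟨t', rfl⟩ := (hf t).1 ht
    exact map_zero_left t'
  · rintro ⟨t', rfl⟩
    rw [map_zero_left, map_zero]

end FaithfullyFlat

/-! ### Faithfully flat descent along B ⊆ A -/

section Descent

variable {A : Type u} [Ring A] (B : Subring A) (N : Type u) [AddCommGroup N] [Module (↥B)ᵐᵒᵖ N]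

/-- `n ↦ n ⊗ 1` as a right `B`-linear map. -/
def tmulOne : N →ₗ[(↥B)ᵐᵒᵖ] NCTensor B N A where
  toFun n := tmul B n (1 : A)
  map_add' n n' := add_tmul n n' 1
  map_smul' b n := by
    change tmul B (op (unop b) • n) (1 : A) = tmul B n ((1 : A) * ((unop b).1 : A))
    rw [smul_tmul, Subring.smul_def, smul_eq_mul, one_mul, mul_one]

/-- `n ⊗ a ↦ (n ⊗ 1) ⊗ a`. -/
def mapTmulOne : NCTensor B N A →+ NCTensor B (NCTensor B N A) A :=
  map (tmulOne B N) (LinearMap.id : A →ₗ[B] A)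

/-- `n ⊗ a ↦ (n ⊗ 1) ⊗ a - (n ⊗ a) ⊗ 1` as a right `B`-linear map. -/
def amitsur : NCTensor B N A →ₗ[(↥B)ᵐᵒᵖ] NCTensor B (NCTensor B N A) A where
  toFun t := mapTmulOne B N t - tmul B t (1 : A)
  map_add' s t := by rw [map_add, add_tmul]; abel
  map_smul' b t := by
    have h1 : mapTmulOne B N (b • t) = b • mapTmulOne B N t := by
      induction t using NCTensor.induction_on with
      | tmul n a => rfl
      | add s t hs ht => rw [smul_add, map_add, map_add, hs, ht, smul_add]
    rw [h1, RingHom.id_apply, smul_sub]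
    exact congrArg _ ((tmulOne B (NCTensor B N A)).map_smul b t)

/-- `(m ⊗ a) ⊗ a' ↦ m ⊗ a a'`. -/
def mulTensor : NCTensor B (NCTensor B N A) A →+ NCTensor B N A :=
  NCTensor.lift (fun t a => op a • t) (fun _ _ _ => smul_add _ _ _)
    (fun t a a' => by rw [MulOpposite.op_add, add_smul])
    (fun t b a => by
      rw [Subring.smul_def, smul_eq_mul, MulOpposite.op_mul, mul_smul]
      congr 1)

theorem mulTensor_tmul (t : NCTensor B N A) (a : A) :
    mulTensor B N (tmul B t a) = op a • t := rfl

theorem mulTensor_mapTmulOne (t : NCTensor B N A) : mulTensor B N (mapTmulOne B N t) = t := by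
  induction t using NCTensor.induction_on with
  | tmul n a => exact congrArg (tmul B n) (one_mul a)
  | add s t hs ht => rw [map_add, map_add, hs, ht]

variable {B} (hA : IsFaithfullyFlat B A)
include hA

/-- After tensoring with A, the map acquires the retraction (n ⊗ a) ⊗ a' ↦ n ⊗ aa'. -/
theorem injective_tmulOne : Function.Injective (tmulOne B N) :=
  (hA.injective_iff _).2 (Function.LeftInverse.injective (mulTensor_mapTmulOne B N))

/-- Faithfully flat descent for elements: `N → N ⊗_B A ⇉ N ⊗_B A ⊗_B A` is exact. -/
theorem exact_amitsur : Function.Exact (tmulOne B N) (amitsur B N) := by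
  rw [hA]
  intro w
  constructor
  · intro hw
    refine ⟨mulTensor B N w, ?_⟩
    -- A contracting homotopy: multiplying the last two factors exhibits each w in the kernel as
    -- coming from `mulTensor B N w`.
    have h : ∀ w, mulTensor B (NCTensor B N A) (map (amitsur B N) LinearMap.id w) =
        mapTmulOne B N (mulTensor B N w) - w := by
      intro w
      induction w using NCTensor.induction_on with
      | tmul t a =>
        rw [map_tmul, mulTensor_tmul, mulTensor_tmul]
        change op a • (mapTmulOne B N t - tmul B t (1 : A)) = _
        rw [smul_sub, right_smul_tmul, op_smul_eq_mul, one_mul]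
        congr 1
        induction t using NCTensor.induction_on with
        | tmul n a' => rfl
        | add s t hs ht => rw [smul_add, map_add, map_add, smul_add, hs, ht]
      | add s t hs ht => simp only [map_add, hs, ht]; abel
    have := h w
    rw [hw, map_zero] at this
    exact (sub_eq_zero.1 this.symm)
  · rintro ⟨t, rfl⟩
    induction t using NCTensor.induction_on with
    | tmul n a =>
      have : amitsur B N (tmulOne B N n) = 0 := sub_self _
      rw [map_tmul, map_tmul, this, zero_tmul]
    | add s t hs ht => rw [map_add, map_add, hs, ht, add_zero]

end Descent

/-! ### From can' and faithful flatness to the equivalence -/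

namespace Coring

variable {A C : Type u} [Ring A] [AddCommGroup C] [Module A C] [Module Aᵐᵒᵖ C]
  [SMulCommClass A Aᵐᵒᵖ C] {𝒞 : Coring A C}

namespace Grouplike

variable (x : 𝒞.Grouplike)

theorem coinv_le_of_isFaithfullyFlat {B' : Subring A} {hB' : B' ≤ x.coinv}
    (hc : Function.Injective (x.can B' hB').left) (hA : IsFaithfullyFlat B' A) :
    x.coinv ≤ B' := by
  intro b hb
  have h1 : tmul B' (1 : A) b = tmul B' b (1 : A) := hc (by
    rw [can_tmul, can_tmul, one_smul, MulOpposite.op_one, one_smul, smul_val hb])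
  -- Identifies A with B' ⊗_{B'} A, to carry 1 ⊗ b = b ⊗ 1 into the descent sequence for N = B'.
  let j : A →ₗ[(↥B')ᵐᵒᵖ] NCTensor B' B' A :=
    { toFun := fun a => tmul B' (1 : B') a
      map_add' := tmul_add _
      map_smul' := fun _ _ => rfl }
  have h2 : amitsur B' B' (tmul B' (1 : B') b) = 0 :=
    sub_eq_zero.2 (congrArg (map j (LinearMap.id : A →ₗ[B'] A)) h1)
  obtain ⟨b', hb'⟩ := (exact_amitsur B' hA _).1 h2
  have h3 := congrArg (lid B' A) hb'
  have h4 : (b' : A) * 1 = (1 : B').1 * b := h3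
  rw [mul_one, Subring.coe_one, one_mul] at h4
  rw [← h4]
  exact b'.2

section Theta

variable (M : Type u) [AddCommGroup M] [Module Aᵐᵒᵖ M]

/-- `m ⊗ a ↦ m ⊗ x a`. -/
def theta : NCTensor x.coinv M A →+ NCTensor A M C :=
  NCTensor.lift (fun m a => tmul A m (op a • x.val)) (fun m m' a => add_tmul m m' _)
    (fun m a a' => by rw [MulOpposite.op_add, add_smul, tmul_add])
    (fun m b a => by
      rw [subring_op_smul, smul_tmul, Subring.smul_def, smul_eq_mul, MulOpposite.op_mul, mul_smul,
        ← smul_val b.2, smul_comm])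

@[simp]
theorem theta_tmul (m : M) (a : A) :
    x.theta M (tmul x.coinv m a) = tmul A m (op a • x.val) := rfl

/-- `m ⊗ (a ⊗ a') ↦ m a ⊗ a'`. -/
def absorb : NCTensor A M (NCTensor x.coinv A A) →+ NCTensor x.coinv M A :=
  NCTensor.lift
    (fun m t => NCTensor.lift (fun a a' => tmul x.coinv (op a • m) a')
      (fun a a' a'' => by rw [MulOpposite.op_add, add_smul, add_tmul])
      (fun a a' a'' => tmul_add _ _ _)
      (fun a b a' => by
        rw [← smul_tmul, subring_op_smul, subring_op_smul, op_smul_eq_mul, MulOpposite.op_mul,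
          mul_smul]) t)
    (fun m m' t => by
      induction t using NCTensor.induction_on with
      | tmul a a' => simp only [lift_tmul, smul_add, add_tmul]
      | add s t hs ht => simp only [map_add, hs, ht]; abel)
    (fun m t t' => map_add _ t t')
    (fun m r t => by
      induction t using NCTensor.induction_on with
      | tmul a a' =>
        simp only [left_smul_tmul, lift_tmul, smul_eq_mul, MulOpposite.op_mul, mul_smul]
      | add s t hs ht => simp only [smul_add, map_add, hs, ht])

theorem absorb_tmul (m : M) (a a' : A) :
    x.absorb M (tmul A m (tmul x.coinv a a')) = tmul x.coinv (op a • m) a' := rfl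

/-- Up to M ⊗_B A ≅ M ⊗_A (A ⊗_B A), θ is M ⊗_A can'; the inverse is can'⁻¹ on the second leg
followed by `absorb`. -/
theorem bijective_theta (hc : Function.Bijective (x.can x.coinv le_rfl).left) :
    Function.Bijective (x.theta M) := by
  let e := LinearEquiv.ofBijective (x.can x.coinv le_rfl).left hc
  have he : ∀ t, e t = (x.can x.coinv le_rfl).left t := fun _ => rfl
  have hθ : ∀ m t, x.theta M (x.absorb M (tmul A m t)) = tmul A m (e t) := fun m t => by
    induction t using NCTensor.induction_on with
    | tmul a a' => rw [absorb_tmul, theta_tmul, he, can_tmul, smul_tmul]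
    | add s t hs ht => rw [tmul_add, map_add, map_add, hs, ht, map_add, tmul_add]
  refine Function.bijective_iff_has_inverse.2
    ⟨fun t => x.absorb M (map LinearMap.id e.symm.toLinearMap t), fun t => ?_, fun t => ?_⟩
  · induction t using NCTensor.induction_on with
    | tmul m a =>
      dsimp only
      rw [theta_tmul, map_tmul, LinearMap.id_apply]
      have : e.symm.toLinearMap (op a • x.val) = tmul x.coinv (1 : A) a := by
        refine (e.symm_apply_eq).2 ?_
        rw [he, can_tmul, one_smul]
      rw [this, absorb_tmul, MulOpposite.op_one, one_smul]
    | add s t hs ht => simp only [map_add] at *; rw [hs, ht]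
  · induction t using NCTensor.induction_on with
    | tmul m d =>
      dsimp only
      rw [map_tmul, LinearMap.id_apply, hθ]
      exact congrArg _ (e.apply_symm_apply d)
    | add s t hs ht => simp only [map_add] at *; rw [hs, ht]

end Theta

/-- `t ↦ ρ(t)` is `θ` applied to `mapTmulOne t` on an induced comodule. -/
theorem induced_coaction_eq (N : ModuleCat.{u} (x.coinv)ᵐᵒᵖ) (t : NCTensor x.coinv N A) :
    (x.induced N).coaction t =
      x.theta (NCTensor x.coinv N A) (mapTmulOne x.coinv N t) := by
  induction t using NCTensor.induction_on with
  | tmul n a => rfl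
  | add s t hs ht =>
    rw [map_add, map_add, ← hs, ← ht]
    exact map_add (x.induced N).coaction s t

/-- Under θ, the coinvariance condition ρ(t) = t ⊗ x on N ⊗_B A becomes the descent condition, whose
solutions are the n ⊗ 1. -/
theorem bijective_unit (hc : Function.Bijective (x.can x.coinv le_rfl).left)
    (hA : IsFaithfullyFlat x.coinv A) (N : ModuleCat.{u} (x.coinv)ᵐᵒᵖ) :
    Function.Bijective (x.unit.app N).hom := by
  constructor
  · intro n n' h
    exact injective_tmulOne N hA (congrArg Subtype.val h)
  · rintro ⟨t, ht⟩
    change NCTensor x.coinv N A at t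
    have ht' : (x.induced N).coaction t = tmul A t x.val := ht
    have h1 : mapTmulOne x.coinv N t = tmul x.coinv t (1 : A) := by
      apply (x.bijective_theta (NCTensor x.coinv N A) hc).1
      rw [← induced_coaction_eq, ht', theta_tmul, MulOpposite.op_one, one_smul]
    obtain ⟨n, hn⟩ := (exact_amitsur N hA t).1 (sub_eq_zero.2 h1)
    exact ⟨n, Subtype.ext hn⟩

section Counit

variable (M : RightComodule 𝒞)

/-- `m ↦ ρ(m) - m ⊗ x` as a right `B`-linear map. -/
def coinvDefect : M.carrier →ₗ[(x.coinv)ᵐᵒᵖ] NCTensor A M.carrier C where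
  toFun m := M.coaction m - tmul A m x.val
  map_add' m n := by rw [map_add, add_tmul]; abel
  map_smul' b m := by
    change M.coaction (op ((unop b).1 : A) • m) - tmul A (op ((unop b).1 : A) • m) x.val =
      op ((unop b).1 : A) • (M.coaction m - tmul A m x.val)
    rw [map_smul, smul_sub, right_smul_tmul, smul_tmul, smul_val (unop b).2]

/-- The right side vanishes by coassociativity when θ(t) = ρ(m), so such t lie in the kernel of the
defect tensored with A. -/
theorem theta_map_coinvDefect (t : NCTensor x.coinv M.carrier A) :
    x.theta (NCTensor A M.carrier C) (map (x.coinvDefect M) LinearMap.id t) =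
      map M.coaction LinearMap.id (x.theta M.carrier t) -
        (assoc A A M.carrier C C).symm (map LinearMap.id 𝒞.comul.left (x.theta M.carrier t)) := by
  induction t using NCTensor.induction_on with
  | tmul m a =>
    rw [map_tmul, theta_tmul, theta_tmul, map_tmul, map_tmul, comul_op_smul_val]
    exact sub_tmul _ _ _
  | add s t hs ht => simp only [map_add, hs, ht]; abel

theorem theta_map_subtype (t : NCTensor x.coinv (M.coinvariants x) A) :
    x.theta M.carrier (map (M.coinvariants x).subtype LinearMap.id t) =
      M.coaction (x.counitLin M t) := by
  induction t using NCTensor.induction_on with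
  | tmul m a =>
    have hm : M.coaction m.1 = tmul A m.1 x.val := m.2
    change tmul A m.1 (op a • x.val) = M.coaction (op a • m.1)
    rw [map_smul, hm, right_smul_tmul]
  | add s t hs ht => simp only [map_add, hs, ht]

theorem bijective_counitLin (hc : Function.Bijective (x.can x.coinv le_rfl).left)
    (hA : IsFaithfullyFlat x.coinv A) : Function.Bijective (x.counitLin M) := by
  constructor
  · refine (injective_iff_map_eq_zero _).2 fun t ht => ?_
    have h := x.theta_map_subtype M t
    rw [ht, map_zero, ← map_zero (x.theta M.carrier)] at h
    -- By flatness it is enough that t vanish in M ⊗_B A, where θ detects it.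
    refine (hA.injective_iff (M.coinvariants x).subtype).1 Subtype.val_injective ?_
    rw [(x.bijective_theta M.carrier hc).1 h, map_zero]
  · intro m
    obtain ⟨t, ht⟩ := (x.bijective_theta M.carrier hc).2 (M.coaction m)
    have h1 : map (x.coinvDefect M) (LinearMap.id : A →ₗ[x.coinv] A) t = 0 := by
      apply (x.bijective_theta (NCTensor A M.carrier C) hc).1
      rw [theta_map_coinvDefect, ht, map_zero, sub_eq_zero, AddEquiv.eq_symm_apply, M.coassoc]
    have hex : Function.Exact (M.coinvariants x).subtype (x.coinvDefect M) := fun m => by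
      constructor
      · intro hm
        exact ⟨⟨m, sub_eq_zero.1 hm⟩, rfl⟩
      · rintro ⟨n, rfl⟩
        exact sub_eq_zero.2 n.2
    obtain ⟨s, rfl⟩ := ((hA _ _ _ _ _).1 hex t).1 h1
    refine ⟨s, ?_⟩
    rw [theta_map_subtype] at ht
    rw [← M.map_id_counit (x.counitLin M s), ht, M.map_id_counit]

end Counit

theorem isEquivalencePair_of_isFaithfullyFlat
    (hc : Function.Bijective (x.can x.coinv le_rfl).left) (hA : IsFaithfullyFlat x.coinv A) :
    x.IsEquivalencePair :=
  x.isEquivalencePair_iff.2 ⟨x.bijective_unit hc hA, fun M => x.bijective_counitLin M hc hA⟩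

end Grouplike

end Coring

end

end GaloisCoring

theorem theorem4p7 {A C : Type u} [Ring A] [AddCommGroup C] [Module A C] [Module Aᵐᵒᵖ C]
    [SMulCommClass A Aᵐᵒᵖ C] (𝒞 : GaloisCoring.Coring A C) (x : 𝒞.Grouplike)
    (hC : GaloisCoring.IsProgenerator A C) (B' : Subring A) (hB' : B' ≤ x.coinv) :
    List.TFAE
      [Function.Bijective (x.can B' hB').left ∧ GaloisCoring.IsFaithfullyFlat B' A,
       Function.Bijective (x.dualCan B' hB') ∧ GaloisCoring.IsProgenerator B' A,
       x.coinv = B' ∧ x.moritaContext.IsStrict,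
       x.coinv = B' ∧ x.IsEquivalencePair] := by
  tfae_have 1 → 4 := by
    rintro ⟨hc, hA⟩
    obtain rfl : x.coinv = B' := le_antisymm (x.coinv_le_of_isFaithfullyFlat hc.1 hA) hB'
    exact ⟨rfl, x.isEquivalencePair_of_isFaithfullyFlat hc hA⟩
  tfae_have 4 → 3 := fun ⟨h, hF⟩ => ⟨h, hF.isStrict hC⟩
  tfae_have 3 → 2 := by
    rintro ⟨rfl, h⟩
    exact GaloisCoring.Coring.Grouplike.progenerator_of_isStrict h
  tfae_have 2 → 1 := fun ⟨hd, hA⟩ =>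
    ⟨x.bijective_can_of_bijective_dualCan hC B' hB' hd hA, hA.isFaithfullyFlat⟩
  tfae_finish
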